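/- Let $g \ge 0$ be an integer. Let $M_g \simeq \mathbb{C}^{3g+1}$ be the affine space, with coordinates $u_0,\dots,u_{g-1},v_0,\dots,v_{g-1},w_0,\dots,w_g$, of matrices $$A(x)=\begin{pmatrix} v(x) & u(x)\\ w(x) & -v(x)\end{pmatrix},\qquad u(x)=x^g+\sum_{i=0}^{g-1}u_ix^i,\quad v(x)=\sum_{i=0}^{g-1}v_ix^i,\quad w(x)=x^{g+1}+\sum_{i=0}^{g}w_ix^i .$$ With $u_g=1$, $w_{g+1}=1$ and all other coefficients outside the above ranges equal to $0$, equip $M_g$ with the Poisson bracket $$\{u_i,u_j\}=\{v_i,v_j\}=0,\quad \{u_i,v_j\}=u_{i+j+1},\quad \{u_i,w_j\}=-2v_{i+j+1},$$ $$\{v_i,w_j\}=w_{i+j+1}-\delta_{0,j}u_i,\quad \{w_i,w_j\}=2(\delta_{0,j}v_i-\delta_{i,0}v_j).$$ Let $\mathbf{H}(A)=-\det A(x)=v(x)^2+u(x)w(x)=x^{2g+1}+\sum_{i=0}^{2g}h_i(A)x^i$ be the moment map, and let $D_i=\{\cdot,h_i\}$ be the Hamiltonian vector field of $h_i$. Let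 $H_g$ be the set of monic polynomials of degree $2g+1$ in $\mathbb{C}[x]$. For $h\in H_g$ put $$M_g(h)=\{A\in M_g : \mathbf{H}(A)=h\},\qquad M_{g,g}(h)=\{A\in M_g(h) : \dim\langle D_0|_A,\dots,D_{g-1}|_A\rangle=g\}.$$ Varieties are complex, reduced and not necessarily irreducible; closures are Zariski closures. For every $h\in H_g$, the maximal stratum $M_{g,g}(h)$ is a smooth quasi-affine variety of dimension $g$ (its dimension is $g$, and the local ring at each of its points is regular of dimension $g$), and its boundary $\overline{M_{g,g}(h)}\setminus M_{g,g}(h)$ is exactly the set of singular points of $M_g(h)$. In particular, every fibre $M_g(h)$ is an affine variety of dimension $g$. -/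

import Mathlib

open scoped Polynomial

noncomputable section

namespace Mumford

/-! ### Classical complex affine varieties

Varieties are sets of points of a complex affine space with its Zariski topology; they are reduced
and need not be irreducible. -/

/-- The complex affine space with coordinates indexed by `σ`, carrying the Zariski topology
(and not the product topology). -/
def AffSp (σ : Type) : Type := σ → ℂ

/-- The coordinates of a point. -/
def coords {σ : Type} : AffSp σ ≃ (σ → ℂ) := Equiv.refl _

/-- The Zariski topology, induced from the prime spectrum of the polynomial ring by sending a point
to the maximal ideal of polynomials vanishing there. -/
instance (σ : Type) : TopologicalSpace (AffSp σ) :=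
  TopologicalSpace.induced
    (fun p : AffSp σ => (MvPolynomial.pointToPoint (coords p) : PrimeSpectrum (MvPolynomial σ ℂ)))
    inferInstance

/-- The closed sets are exactly the zero loci of ideals of polynomials. -/
theorem isClosed_iff_zeroLocus {σ : Type} (S : Set (AffSp σ)) :
    IsClosed S ↔ ∃ I : Ideal (MvPolynomial σ ℂ), S = coords ⁻¹' MvPolynomial.zeroLocus ℂ I := by
  have key : ∀ I : Ideal (MvPolynomial σ ℂ),
      (fun p : AffSp σ =>
        (MvPolynomial.pointToPoint (coords p) : PrimeSpectrum (MvPolynomial σ ℂ))) ⁻¹'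
          PrimeSpectrum.zeroLocus (I : Set (MvPolynomial σ ℂ)) =
        coords ⁻¹' MvPolynomial.zeroLocus ℂ I := by
    intro I
    ext x
    simp only [Set.mem_preimage, PrimeSpectrum.mem_zeroLocus, MvPolynomial.mem_zeroLocus_iff,
      MvPolynomial.pointToPoint]
    exact ⟨fun h p hp => (MvPolynomial.mem_vanishingIdeal_singleton_iff (coords x) p).1 (h hp),
      fun h p hp => (MvPolynomial.mem_vanishingIdeal_singleton_iff (coords x) p).2 (h p hp)⟩
  constructor
  · intro h
    obtain ⟨T, hT, rfl⟩ := isClosed_induced_iff.1 h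
    obtain ⟨I, rfl⟩ := (PrimeSpectrum.isClosed_iff_zeroLocus_ideal T).1 hT
    exact ⟨I, key I⟩
  · rintro ⟨I, rfl⟩
    exact isClosed_induced_iff.2
      ⟨_, PrimeSpectrum.isClosed_zeroLocus (I : Set (MvPolynomial σ ℂ)), key I⟩

/-- An affine variety: a Zariski closed set of an affine space. -/
def IsAffineVariety {σ : Type} (S : Set (AffSp σ)) : Prop := IsClosed S

/-- A quasi-affine variety: a Zariski open subset of a Zariski closed set of an affine space. -/
def IsQuasiAffineVariety {σ : Type} (S : Set (AffSp σ)) : Prop := IsLocallyClosed S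

/-- The dimension of a variety: the supremum of the lengths of chains of irreducible closed
subsets (it is `⊥` for the empty set). -/
def dim {σ : Type} (S : Set (AffSp σ)) : WithBot ℕ∞ := topologicalKrullDim S

/-- The ring of polynomial functions on `S`, i.e. the coordinate ring of the Zariski closure. -/
abbrev CoordRing {σ : Type} (S : Set (AffSp σ)) : Type :=
  MvPolynomial σ ℂ ⧸ (MvPolynomial.vanishingIdeal ℂ (coords '' S) : Ideal (MvPolynomial σ ℂ))

/-- Evaluation of polynomial functions on `S` at a point of `S`. -/
def evalAt {σ : Type} (S : Set (AffSp σ)) (p : S) : CoordRing S →+* ℂ :=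
  Ideal.Quotient.lift _ (MvPolynomial.aeval (R := ℂ) (coords p.1)).toRingHom
    fun _ hf => hf (coords p.1) ⟨p.1, p.2, rfl⟩

instance {σ : Type} (S : Set (AffSp σ)) (p : S) : (RingHom.ker (evalAt S p)).IsPrime :=
  RingHom.ker_isPrime _

/-- The local ring of the variety `S` at its point `p`: the localization of the ring of polynomial
functions at the maximal ideal of functions vanishing at `p`. For a quasi-affine `S`, which is open
in its closure, this is the ring of germs at `p` of regular functions on `S`. -/
abbrev LocalRingAt {σ : Type} (S : Set (AffSp σ)) (p : S) : Type :=
  Localization.AtPrime (RingHom.ker (evalAt S p))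

/-- `S` is smooth at `p` if its local ring at `p` is regular. -/
def IsSmoothAt {σ : Type} (S : Set (AffSp σ)) (p : S) : Prop :=
  IsRegularLocalRing (LocalRingAt S p)

/-- The set of singular points of `S`. -/
def singularLocus {σ : Type} (S : Set (AffSp σ)) : Set (AffSp σ) :=
  {p | ∃ hp : p ∈ S, ¬ IsSmoothAt S ⟨p, hp⟩}

/-- `S` is smooth of dimension `d`: it has dimension `d`, it is smooth at each of its points, and
its dimension at each of its points is `d` (so all its irreducible components have
dimension `d`). -/
def IsSmoothOfDim {σ : Type} (S : Set (AffSp σ)) (d : ℕ) : Prop :=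
  dim S = d ∧ ∀ p : S, IsSmoothAt S p ∧ ringKrullDim (LocalRingAt S p) = d

/-- The boundary of a stratum: its Zariski closure minus the stratum itself. -/
def boundary {σ : Type} (S : Set (AffSp σ)) : Set (AffSp σ) := closure S \ S

/-! ### The Mumford system -/

/-- Indices of the `3g+1` coordinates `u_0, …, u_{g-1}`, `v_0, …, v_{g-1}`, `w_0, …, w_g`,
in this order. -/
abbrev Coord (g : ℕ) : Type := Fin g ⊕ Fin g ⊕ Fin (g + 1)

section Polynomials

variable {R : Type} [CommRing R] {g : ℕ}

/-- `u(x) = x^g + u_{g-1} x^{g-1} + ⋯ + u_0`. -/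
def uPoly (a : Coord g → R) : R[X] :=
  Polynomial.X ^ g + ∑ i : Fin g, Polynomial.C (a (.inl i)) * Polynomial.X ^ (i : ℕ)

/-- `v(x) = v_{g-1} x^{g-1} + ⋯ + v_0`. -/
def vPoly (a : Coord g → R) : R[X] :=
  ∑ i : Fin g, Polynomial.C (a (.inr (.inl i))) * Polynomial.X ^ (i : ℕ)

/-- `w(x) = x^{g+1} + w_g x^g + ⋯ + w_0`. -/
def wPoly (a : Coord g → R) : R[X] :=
  Polynomial.X ^ (g + 1) +
    ∑ i : Fin (g + 1), Polynomial.C (a (.inr (.inr i))) * Polynomial.X ^ (i : ℕ)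

/-- The traceless polynomial matrix with rows `(v(x), u(x))` and `(w(x), -v(x))`. -/
def polyMatrix (a : Coord g → R) : Matrix (Fin 2) (Fin 2) R[X] :=
  !![vPoly a, uPoly a; wPoly a, -vPoly a]

/-- The moment map `A ↦ -det A(x) = v(x)² + u(x) w(x)`. -/
def momentMap (a : Coord g → R) : R[X] := -(polyMatrix a).det

end Polynomials

/-- The phase space `M_g`, an affine space of dimension `3g+1`: a matrix `A(x)` is given by the
coefficients of its entries, and is recovered as `polyMatrix (coords A)`. -/
abbrev PhaseSpace (g : ℕ) : Type := AffSp (Coord g)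

/-- The set `H_g` of monic polynomials of degree `2g+1`. -/
def monicPolys (g : ℕ) : Set ℂ[X] := {h | h.Monic ∧ h.natDegree = 2 * g + 1}

/-- The fibre `M_g(h)` of the moment map. -/
def fibre (g : ℕ) (h : ℂ[X]) : Set (PhaseSpace g) := {A | momentMap (coords A) = h}

/-- The coefficient `u_k` as a function on the phase space, with `u_g = 1` and `u_k = 0` for
`k > g`. -/
def uFun (g k : ℕ) : MvPolynomial (Coord g) ℂ :=
  (uPoly (MvPolynomial.X : Coord g → MvPolynomial (Coord g) ℂ)).coeff k

/-- The coefficient `v_k` as a function on the phase space, with `v_k = 0` for `k ≥ g`. -/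
def vFun (g k : ℕ) : MvPolynomial (Coord g) ℂ :=
  (vPoly (MvPolynomial.X : Coord g → MvPolynomial (Coord g) ℂ)).coeff k

/-- The coefficient `w_k` as a function on the phase space, with `w_{g+1} = 1` and `w_k = 0` for
`k > g + 1`. -/
def wFun (g k : ℕ) : MvPolynomial (Coord g) ℂ :=
  (wPoly (MvPolynomial.X : Coord g → MvPolynomial (Coord g) ℂ)).coeff k

/-- The Poisson brackets of the coordinate functions:
`{u_i, u_j} = {v_i, v_j} = 0`, `{u_i, v_j} = u_{i+j+1}`, `{u_i, w_j} = -2 v_{i+j+1}`,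
`{v_i, w_j} = w_{i+j+1} - δ_{0,j} u_i`, `{w_i, w_j} = 2 (δ_{0,j} v_i - δ_{i,0} v_j)`. -/
def coordBracket (g : ℕ) : Coord g → Coord g → MvPolynomial (Coord g) ℂ
  | .inl _, .inl _ => 0
  | .inl i, .inr (.inl j) => uFun g (i + j + 1)
  | .inr (.inl i), .inl j => -uFun g (j + i + 1)
  | .inr (.inl _), .inr (.inl _) => 0
  | .inl i, .inr (.inr j) => -2 * vFun g (i + j + 1)
  | .inr (.inr i), .inl j => 2 * vFun g (j + i + 1)
  | .inr (.inl i), .inr (.inr j) =>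
      wFun g (i + j + 1) - (if (j : ℕ) = 0 then uFun g i else 0)
  | .inr (.inr i), .inr (.inl j) =>
      -(wFun g (j + i + 1) - (if (i : ℕ) = 0 then uFun g j else 0))
  | .inr (.inr i), .inr (.inr j) =>
      2 * ((if (j : ℕ) = 0 then vFun g i else 0) - (if (i : ℕ) = 0 then vFun g j else 0))

/-- The Poisson bracket on polynomial functions, the biderivation extending `coordBracket`. -/
def poissonBracket (g : ℕ) (F G : MvPolynomial (Coord g) ℂ) : MvPolynomial (Coord g) ℂ :=
  ∑ a : Coord g, ∑ b : Coord g,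
    coordBracket g a b * MvPolynomial.pderiv a F * MvPolynomial.pderiv b G

/-- The function `h_i` on the phase space: the coefficient of `x^i` in `v(x)² + u(x) w(x)`. -/
def hFun (g i : ℕ) : MvPolynomial (Coord g) ℂ :=
  (momentMap (MvPolynomial.X : Coord g → MvPolynomial (Coord g) ℂ)).coeff i

/-- The value `D_i|_A` at `A` of the Hamiltonian vector field `D_i = {·, h_i}`, as the vector of
its components in the coordinates. -/
def hamiltonianField (g i : ℕ) (A : PhaseSpace g) : Coord g → ℂ := fun c =>
  MvPolynomial.eval (coords A) (poissonBracket g (MvPolynomial.X c) (hFun g i))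

/-- The stratum `M_{g,i}`: the points `A` where the span of `D_0|_A, …, D_{g-1}|_A` has
dimension `i`. -/
def stratum (g i : ℕ) : Set (PhaseSpace g) :=
  {A | Module.finrank ℂ
    (Submodule.span ℂ (Set.range fun k : Fin g => hamiltonianField g k A)) = i}

/-- The stratum `M_{g,i}(h) = M_g(h) ∩ M_{g,i}` of the fibre. -/
def fibreStratum (g i : ℕ) (h : ℂ[X]) : Set (PhaseSpace g) := fibre g h ∩ stratum g i

end Mumford

end

/-! Let `I` be the ideal of the `2g+1` equations `h_i = const` in the `3g+1` coordinates. The heart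
of the proof is a bound on the height of an arbitrary prime `P ⊇ I`. Over the residue field `K` of
`P`, the monic gcd `D` of `u`, `v`, `w` divides `h`, which splits over `ℂ`; hence `D` has constant
coefficients. A tangent vector annihilating the elements of `P` therefore gives variations of `u`,
`v`, `w` that are divisible by `D`. After division they form a syzygy of bounded degree of the
coprime triple `(w/D, 2v/D, u/D)`, and such syzygies have dimension at most `g - deg D`
(`finrank_ker_syzygyMap_le`). So the differentials of elements of `P` have rank at least `2g+1+deg
D`, and this rank bounds the height from below (`le_height_ker`).

Consequently `I` is a complete intersection, and at a prime of height `2g+1` the polynomials `u`,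
`v`, `w` are coprime. Coprimality makes the differential of the moment map surjective, so `I` is
reduced at those primes. Macaulay's unmixedness theorem (`height_eq_length_of_colon`, built here
from regular sequences in regular local rings) says that these are all the associated primes, so `I`
is radical. The same height bound at minimal primes shows that the coprime locus is dense in the
fibre (`vanishingIdeal_coprimeLocus`).

The coprime locus has two more descriptions. By the Jacobian criterion it is the smooth locus, since
a common root `x` gives the relation `∑ x^i dh_i = 0` (`isSmoothAt_iff`). It is also the maximal
stratum (`mem_stratum_iff`): the Poisson tensor has kernel of dimension at most `g+1` and kills
`dh_g, …, dh_{2g}`, so independence of all `dh_i` gives independence of `D_0, …, D_{g-1}`;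
conversely, the tensor turns the relation above into one among the `D_i`. Density and these two
identifications give the statement about the boundary, and dimensions are read off the local rings.
-/

open scoped Polynomial

/-! ### Regular local rings are domains with maximal regular sequences -/

section RegularLocal

open IsLocalRing RingTheory.Sequence
open scoped Pointwise

variable {R : Type*} [CommRing R]

/-- Killing an element of `𝔪 \ 𝔪²` lowers the embedding dimension. -/
theorem spanFinrank_maximalIdeal_quotient_add_one_le [IsLocalRing R] [IsNoetherianRing R] {x : R}
    (hx : x ∈ maximalIdeal R) (hx2 : x ∉ maximalIdeal R ^ 2)
    [IsLocalRing (R ⧸ Ideal.span {x})] :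
    (maximalIdeal (R ⧸ Ideal.span {x})).spanFinrank + 1 ≤ (maximalIdeal R).spanFinrank := by
  classical
  obtain ⟨s, hcard, hspan⟩ :=
    (IsNoetherian.noetherian (maximalIdeal R)).exists_span_finset_card_eq_spanFinrank
  have hxs : x ∈ Submodule.span R (s : Set R) := hspan ▸ hx
  obtain ⟨f, -, hf⟩ := Submodule.mem_span_finset.mp hxs
  have hsm : ∀ a ∈ s, a ∈ maximalIdeal R := fun a ha => hspan ▸ Submodule.subset_span ha
  obtain ⟨j, hj, hu⟩ : ∃ j ∈ s, IsUnit (f j) := by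
    by_contra! hcon
    refine hx2 (hf ▸ Submodule.sum_mem _ fun a ha => ?_)
    rw [pow_two]
    exact Ideal.mul_mem_mul ((mem_maximalIdeal _).2 (hcon a ha)) (hsm a ha)
  have hmap : maximalIdeal (R ⧸ Ideal.span {x}) =
      Ideal.span (((s.erase j).image (Ideal.Quotient.mk (Ideal.span {x})) :
        Finset (R ⧸ Ideal.span {x})) : Set (R ⧸ Ideal.span {x})) := by
    have h1 : maximalIdeal (R ⧸ Ideal.span {x}) =
        (maximalIdeal R).map (Ideal.Quotient.mk (Ideal.span {x})) := by
      have hl : IsLocalHom (Ideal.Quotient.mk (Ideal.span {x})) :=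
        IsLocalHom.of_surjective _ Ideal.Quotient.mk_surjective
      have := ((local_hom_TFAE (Ideal.Quotient.mk (Ideal.span {x}))).out 0 4).1 hl
      rw [← this, Ideal.map_comap_of_surjective _ Ideal.Quotient.mk_surjective]
    have h2 : (maximalIdeal R) = Ideal.span (s : Set R) := hspan.symm
    rw [h1, h2, Ideal.map_span]
    refine le_antisymm (Ideal.span_le.2 ?_) (Ideal.span_mono ?_)
    · rintro _ ⟨a, ha, rfl⟩
      by_cases haj : a = j
      · subst haj
        have hsum : f a • a = x - ∑ b ∈ s.erase a, f b • b := by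
          rw [← hf, ← Finset.add_sum_erase s _ hj]; ring
        have : Ideal.Quotient.mk (Ideal.span {x}) (f a * a) ∈
            Ideal.span (((s.erase a).image (Ideal.Quotient.mk (Ideal.span {x})) :
              Finset (R ⧸ Ideal.span {x})) : Set (R ⧸ Ideal.span {x})) := by
          rw [← smul_eq_mul, hsum, map_sub, map_sum]
          refine Ideal.sub_mem _ ?_ (Submodule.sum_mem _ fun b hb => ?_)
          · rw [Ideal.Quotient.eq_zero_iff_mem.2 (Ideal.mem_span_singleton_self x)]
            exact zero_mem _
          · rw [smul_eq_mul, map_mul]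
            exact Ideal.mul_mem_left _ _ (Ideal.subset_span
              (Finset.mem_coe.2 (Finset.mem_image_of_mem _ hb)))
        rw [map_mul] at this
        exact ((Ideal.unit_mul_mem_iff_mem _ (hu.map _)).1 this)
      · exact Ideal.subset_span (Finset.mem_coe.2
          (Finset.mem_image_of_mem _ (Finset.mem_erase.2 ⟨haj, ha⟩)))
    · rintro _ hb
      obtain ⟨a, ha, rfl⟩ := Finset.mem_image.1 (Finset.mem_coe.1 hb)
      exact ⟨a, (Finset.mem_erase.1 ha).2, rfl⟩
  have h3 : (maximalIdeal (R ⧸ Ideal.span {x})).spanFinrank ≤ (s.erase j).card := by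
    rw [hmap]
    refine (Submodule.spanFinrank_span_le_ncard_of_finite (Finset.finite_toSet _)).trans ?_
    rw [Set.ncard_coe_finset]
    exact Finset.card_image_le
  have h4 := Finset.card_erase_add_one hj
  omega

/-- The embedding dimension drops by at least one and the Krull dimension by at most one; since the
former always bounds the latter, both drop by exactly one. -/
theorem isRegularLocalRing_quotient_span_singleton [IsRegularLocalRing R] {x : R}
    (hx : x ∈ maximalIdeal R) (hx2 : x ∉ maximalIdeal R ^ 2) :
    IsRegularLocalRing (R ⧸ Ideal.span {x}) ∧
      (maximalIdeal R).spanFinrank =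
        ringKrullDim (R ⧸ Ideal.span {x}) + 1 := by
  have hne : Ideal.span {x} ≠ (⊤ : Ideal R) := fun h =>
    (maximalIdeal.isMaximal R).ne_top (top_le_iff.1
      (h ▸ (Ideal.span_singleton_le_iff_mem _).2 hx))
  have : Nontrivial (R ⧸ Ideal.span {x}) := Ideal.Quotient.nontrivial_iff.2 hne
  have : IsLocalRing (R ⧸ Ideal.span {x}) :=
    IsLocalRing.of_surjective' _ Ideal.Quotient.mk_surjective
  have h1 := spanFinrank_maximalIdeal_quotient_add_one_le hx hx2
  have h2 : ringKrullDim R ≤ ringKrullDim (R ⧸ Ideal.span {x}) + 1 := by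
    rw [← IsLocalRing.maximalIdeal_height_eq_ringKrullDim]
    exact Ideal.height_le_ringKrullDim_quotient_add_one hx
  rw [← IsRegularLocalRing.spanFinrank_maximalIdeal] at h2
  have h3 := ringKrullDim_le_spanFinrank_maximalIdeal (R ⧸ Ideal.span {x})
  have h1' : ((maximalIdeal (R ⧸ Ideal.span {x})).spanFinrank : WithBot ℕ∞) + 1 ≤
      (maximalIdeal R).spanFinrank := by exact_mod_cast h1
  have hfin : ∃ d : ℕ, ringKrullDim (R ⧸ Ideal.span {x}) = d := by
    have hb : ringKrullDim (R ⧸ Ideal.span {x}) ≠ ⊥ := fun h => by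
      have := ringKrullDim_nonneg_of_nontrivial (R := R ⧸ Ideal.span {x})
      rw [h] at this; simp at this
    obtain ⟨e, he⟩ := WithBot.ne_bot_iff_exists.1 hb
    have ht : e ≠ ⊤ := fun h => by
      rw [← he, h] at h3
      have : (⊤ : ℕ∞) ≤ ((maximalIdeal (R ⧸ Ideal.span {x})).spanFinrank : ℕ∞) := by
        exact_mod_cast h3
      simp at this
    obtain ⟨d, hd⟩ := ENat.ne_top_iff_exists.1 ht
    exact ⟨d, by rw [← he, ← hd]; rfl⟩
  obtain ⟨d, hd⟩ := hfin
  rw [hd] at h2 h3 ⊢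
  have h2' : (maximalIdeal R).spanFinrank ≤ d + 1 := by exact_mod_cast h2
  have h3' : d ≤ (maximalIdeal (R ⧸ Ideal.span {x})).spanFinrank := by exact_mod_cast h3
  constructor
  · refine IsRegularLocalRing.of_spanFinrank_maximalIdeal_le _ ?_
    rw [hd]; exact_mod_cast (by omega : (maximalIdeal (R ⧸ Ideal.span {x})).spanFinrank ≤ d)
  · exact_mod_cast (by omega : (maximalIdeal R).spanFinrank = d + 1)

/-- A regular local ring is a domain, and its maximal ideal contains a regular sequence whose
length is the dimension. -/
theorem IsRegularLocalRing.isDomain_and_exists_isRegular (n : ℕ) :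
    ∀ (R : Type*) [CommRing R] [IsRegularLocalRing R], (maximalIdeal R).spanFinrank = n →
      IsDomain R ∧ ∃ rs : List R, rs.length = n ∧ (∀ r ∈ rs, r ∈ maximalIdeal R) ∧
        IsRegular R rs := by
  induction n with
  | zero =>
    intro R _ _ h
    have hb : maximalIdeal R = ⊥ :=
      (Submodule.spanFinrank_eq_zero_iff_eq_bot (IsNoetherian.noetherian _)).1 h
    have hf : IsField R := IsLocalRing.isField_iff_maximalIdeal_eq.2 hb
    exact ⟨hf.isDomain, [], rfl, by simp, IsRegular.nil R R⟩
  | succ n ih =>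
    intro R _ _ h
    have hdim : ringKrullDim R = (n + 1 : ℕ) := by
      rw [← IsRegularLocalRing.spanFinrank_maximalIdeal, h]
    have hlt : maximalIdeal R ^ 2 < maximalIdeal R :=
      IsLocalRing.maximalIdeal_sq_lt_of_ringKrullDim_ne_zero (by
        rw [hdim]; exact_mod_cast Nat.succ_ne_zero n)
    -- Prime avoidance: `x` lies outside `𝔪²`, so that the quotient stays regular, and outside every
    -- minimal prime, which is what will make `R` a domain.
    obtain ⟨x, hx, hx'⟩ : ∃ x ∈ maximalIdeal R,
        x ∉ ⋃ i ∈ insert (maximalIdeal R ^ 2) (minimalPrimes R), (i : Set R) := by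
      by_contra! hcon
      have hfin : (insert (maximalIdeal R ^ 2) (minimalPrimes R)).Finite :=
        (minimalPrimes.finite_of_isNoetherianRing R).insert _
      obtain ⟨i, hi, hle⟩ := (Ideal.subset_union_prime_finite hfin (f := fun i => i)
        (maximalIdeal R ^ 2) (maximalIdeal R ^ 2) (by
          intro i hi h1 _
          exact ((Set.mem_insert_iff.1 hi).resolve_left h1).1.1)).1 hcon
      rcases Set.mem_insert_iff.1 hi with rfl | hi
      · exact absurd hle (not_le_of_gt hlt)
      · have hpr := hi.1.1
        have he : i = maximalIdeal R := le_antisymm (le_maximalIdeal hpr.ne_top) hle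
        have h0 : i.height = 0 := Ideal.height_eq_zero_iff.2 hi
        have := IsLocalRing.maximalIdeal_height_eq_ringKrullDim (R := R)
        rw [← he, h0, hdim] at this
        exact absurd this (by exact_mod_cast (Nat.succ_ne_zero n).symm)
    simp only [Set.mem_iUnion, SetLike.mem_coe, exists_prop, not_exists, not_and,
      Set.mem_insert_iff, forall_eq_or_imp] at hx'
    obtain ⟨hx2, hxmin⟩ := hx'
    obtain ⟨hreg, hd⟩ := isRegularLocalRing_quotient_span_singleton hx hx2
    rw [h, ← IsRegularLocalRing.spanFinrank_maximalIdeal] at hd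
    obtain ⟨hdom, rs, hlen, hmem, hrs⟩ := ih (R ⧸ Ideal.span {x}) (by
      have : n + 1 = (maximalIdeal (R ⧸ Ideal.span {x})).spanFinrank + 1 := by exact_mod_cast hd
      omega)
    have hprime : (Ideal.span {x}).IsPrime := (Ideal.Quotient.isDomain_iff_prime _).1 hdom
    obtain ⟨q, hq, hqle⟩ := Ideal.exists_minimalPrimes_le (I := ⊥) (J := Ideal.span {x}) bot_le
    have hqp : q.IsPrime := hq.1.1
    -- Since `x ∉ q` and `q ⊆ (x)`, every element of `q` is `x` times an element of `q`; Nakayama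
    -- gives `q = 0`.
    have hq0 : q = ⊥ := by
      refine Submodule.eq_bot_of_le_smul_of_le_jacobson_bot (Ideal.span {x}) q
        (IsNoetherian.noetherian q) ?_ ?_
      · intro a ha
        obtain ⟨b, rfl⟩ := Ideal.mem_span_singleton'.1 (hqle ha)
        have hb : b ∈ q := (hqp.mem_or_mem ha).resolve_right (hxmin q hq)
        rw [mul_comm]
        exact Submodule.smul_mem_smul (Ideal.mem_span_singleton_self x) hb
      · rw [IsLocalRing.jacobson_eq_maximalIdeal _ bot_ne_top]
        exact (Ideal.span_singleton_le_iff_mem _).2 hx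
    have hdomR : IsDomain R := by
      have : IsDomain (R ⧸ (⊥ : Ideal R)) := (Ideal.Quotient.isDomain_iff_prime _).2 (hq0 ▸ hqp)
      exact (RingEquiv.quotientBot R).symm.toMulEquiv.isDomain _
    have hx0 : x ≠ 0 := fun h0 => hx2 (h0 ▸ zero_mem _)
    refine ⟨hdomR, ?_⟩
    choose! φ hφ using (Ideal.Quotient.mk_surjective (I := Ideal.span {x}))
    have hmap : (rs.map φ).map (Ideal.Quotient.mk (Ideal.span {x})) = rs := by
      rw [List.map_map]
      conv_rhs => rw [← List.map_id rs]
      exact List.map_congr_left fun a _ => hφ a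
    refine ⟨x :: rs.map φ, by simp [hlen], ?_, ?_⟩
    · intro r hr
      rcases List.mem_cons.1 hr with rfl | hr
      · exact hx
      · obtain ⟨a, ha, rfl⟩ := List.mem_map.1 hr
        have := hmem a ha
        by_contra hcon
        have hu : IsUnit (φ a) := by simpa [mem_maximalIdeal] using hcon
        have : IsUnit a := by rw [← hφ a]; exact hu.map _
        exact (mem_maximalIdeal _).1 (hmem a ha) this
    · rw [isRegular_cons_iff']
      refine ⟨fun a b hab => mul_left_cancel₀ hx0 hab, ?_⟩
      rw [hmap]
      have hI : (x • (⊤ : Submodule R R)) = Ideal.span {x} := by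
        ext y
        rw [Submodule.mem_smul_pointwise_iff_exists, Ideal.mem_span_singleton']
        simp [mul_comm]
      let e0 : QuotSMulTop x R ≃ₗ[R] (R ⧸ Ideal.span {x}) := Submodule.quotEquivOfEq _ _ hI
      let e : QuotSMulTop x R ≃ₗ[R ⧸ Ideal.span {x}] (R ⧸ Ideal.span {x}) :=
        { e0 with
          map_smul' := by
            intro r y
            obtain ⟨r, rfl⟩ := Ideal.Quotient.mk_surjective r
            exact e0.map_smul r y }
      exact (e.isRegular_congr rs).2 hrs

end RegularLocal

/-! ### Depth, and its bound by the dimension of associated primes -/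

section Depth

open IsLocalRing RingTheory.Sequence CategoryTheory Abelian Limits
open scoped Pointwise

universe u

variable {R : Type u} [CommRing R] [IsLocalRing R] [IsNoetherianRing R]

/-- Killing a regular element lowers the length of available regular sequences by at most one. -/
theorem exists_isRegular_quotSMulTop {M : Type u} [AddCommGroup M] [Module R M] [Module.Finite R M]
    {n : ℕ} (h : ∃ rs : List R, rs.length = n + 1 ∧ (∀ r ∈ rs, r ∈ maximalIdeal R) ∧
      IsRegular M rs) {x : R} (hx : x ∈ maximalIdeal R) (hreg : IsSMulRegular M x) :
    ∃ rs : List R, rs.length = n ∧ (∀ r ∈ rs, r ∈ maximalIdeal R) ∧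
      IsRegular (QuotSMulTop x M) rs := by
  obtain ⟨rs, hlen, hmem, hrs⟩ := h
  have : Nontrivial M := hrs.nontrivial
  have hlt (L : Type u) [AddCommGroup L] [Module R L] [Module.Finite R L] [Nontrivial L] :
      maximalIdeal R • (⊤ : Submodule R L) < ⊤ :=
    (Submodule.top_ne_ideal_smul_of_le_jacobson_annihilator (maximalIdeal_le_jacobson _)).symm.lt_top
  have hsupp : Module.support R (R ⧸ maximalIdeal R) =
      PrimeSpectrum.zeroLocus (maximalIdeal R : Set R) := by
    rw [Module.support_eq_zeroLocus, Ideal.annihilator_quotient]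
  -- Depth through `Ext` from the residue field `k`: `Ext^i(k, M) = 0` for `i ≤ n`. In the long
  -- exact sequence of multiplication by `x`, `Ext^i(k, M/xM)` sits between `Ext^i(k, M)` and
  -- `Ext^(i+1)(k, M)`, hence vanishes for `i < n`.
  have hext := ModuleCat.subsingleton_ext_of_exists_isRegular (maximalIdeal R)
    (ModuleCat.of R (R ⧸ maximalIdeal R)) hsupp.subset (ModuleCat.of R M) (hlt M) rs hmem hrs
  have : Nontrivial (QuotSMulTop x M) := nontrivial_quotSMulTop_of_mem_maximalIdeal M hx
  refine ModuleCat.exists_isRegular_of_exists_subsingleton_ext (maximalIdeal R) n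
    (ModuleCat.of R (QuotSMulTop x M)) (hlt (QuotSMulTop x M))
    (ModuleCat.of R (R ⧸ maximalIdeal R)) hsupp fun i hi => ?_
  have hreg' : IsSMulRegular (ModuleCat.of R M) x := hreg
  have zero1 := AddCommGrpCat.isZero_of_iff_subsingleton.mpr (hext i (by omega))
  have zero2 := AddCommGrpCat.isZero_of_iff_subsingleton.mpr (hext (i + 1) (by omega))
  exact AddCommGrpCat.subsingleton_of_isZero <| ShortComplex.Exact.isZero_of_both_zeros
    ((Ext.covariant_sequence_exact₃' (ModuleCat.of R (R ⧸ maximalIdeal R))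
      hreg'.smulShortComplex_shortExact) i (i + 1) rfl)
    (zero1.eq_zero_of_src _) (zero2.eq_zero_of_tgt _)

/-- Killing a weakly regular sequence lowers the length of available regular sequences by at most
its length. -/
theorem exists_isRegular_quotient (xs : List R) :
    ∀ {M : Type u} [AddCommGroup M] [Module R M] [Module.Finite R M] {n : ℕ},
      (∃ rs : List R, rs.length = n + xs.length ∧ (∀ r ∈ rs, r ∈ maximalIdeal R) ∧
        IsRegular M rs) →
      (∀ x ∈ xs, x ∈ maximalIdeal R) → IsWeaklyRegular M xs →
      ∃ rs : List R, rs.length = n ∧ (∀ r ∈ rs, r ∈ maximalIdeal R) ∧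
        IsRegular (M ⧸ Ideal.ofList xs • (⊤ : Submodule R M)) rs := by
  induction xs with
  | nil =>
    rintro M _ _ _ n ⟨rs, hlen, hmem, hrs⟩ - -
    have he : Ideal.ofList ([] : List R) • (⊤ : Submodule R M) = ⊥ := by simp
    exact ⟨rs, hlen, hmem, ((Submodule.quotEquivOfEqBot _ he).isRegular_congr rs).2 hrs⟩
  | cons x xs ih =>
    intro M _ _ _ n h hxs hreg
    obtain ⟨h1, h2⟩ := (isWeaklyRegular_cons_iff M x xs).1 hreg
    obtain ⟨rs, hlen, hmem, hrs⟩ := ih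
      (exists_isRegular_quotSMulTop h (hxs x List.mem_cons_self) h1)
      (fun z hz => hxs z (List.mem_cons_of_mem _ hz)) h2
    exact ⟨rs, hlen, hmem,
      ((Submodule.quotOfListConsSMulTopEquivQuotSMulTopInner M x xs).isRegular_congr rs).2 hrs⟩

/-- The length of a regular sequence on `M` is at most the dimension of `R ⧸ p` for every prime `p`
killing a nonzero element of `M`. -/
theorem length_le_ringKrullDim_quotient_of_smul_eq_zero (n : ℕ) :
    ∀ {M : Type u} [AddCommGroup M] [Module R M] [Module.Finite R M],
      (∃ rs : List R, rs.length = n ∧ (∀ r ∈ rs, r ∈ maximalIdeal R) ∧ IsRegular M rs) →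
      ∀ (p : Ideal R) [p.IsPrime] (z : M), z ≠ 0 → (∀ r ∈ p, r • z = 0) →
        (n : WithBot ℕ∞) ≤ ringKrullDim (R ⧸ p) := by
  induction n with
  | zero =>
    intro M _ _ _ _ p hp z _ _
    have : Nontrivial (R ⧸ p) := Ideal.Quotient.nontrivial_iff.2 hp.ne_top
    exact_mod_cast ringKrullDim_nonneg_of_nontrivial
  | succ n ih =>
    rintro M _ _ _ ⟨rs, hlen, hmem, hrs⟩ p hp z hz hpz
    obtain ⟨x, xs, rfl⟩ := List.exists_cons_of_length_eq_add_one hlen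
    obtain ⟨hx, hxs⟩ := (isRegular_cons_iff M x xs).1 hrs
    have hxm := hmem x List.mem_cons_self
    let U : Submodule R M := Submodule.torsionBySet R M (p : Set R)
    have hU (a : M) : a ∈ U ↔ ∀ r ∈ p, r • a = 0 := by
      simp [U, Submodule.mem_torsionBySet_iff]
    -- If `U ⊆ xM`, then `U = xU`, because `x` is regular and so `x b ∈ U` forces `b ∈ U`; Nakayama
    -- would make `U` zero, although `z ∈ U`.
    obtain ⟨y, hyU, hy⟩ : ∃ y ∈ U, (Submodule.Quotient.mk y : QuotSMulTop x M) ≠ 0 := by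
      by_contra! hcon
      have hU0 : U = ⊥ := by
        refine Submodule.eq_bot_of_le_smul_of_le_jacobson_bot (Ideal.span {x}) U
          (IsNoetherian.noetherian U) (fun a ha => ?_) ?_
        · have h1 := hcon a ha
          rw [Submodule.Quotient.mk_eq_zero, Submodule.mem_smul_pointwise_iff_exists] at h1
          obtain ⟨b, -, rfl⟩ := h1
          refine Submodule.smul_mem_smul (Ideal.mem_span_singleton_self x) ((hU b).2 fun r hr => ?_)
          have h2 := (hU _).1 ha r hr
          rw [smul_comm] at h2
          exact hx (h2.trans (smul_zero x).symm)
        · rw [IsLocalRing.jacobson_eq_maximalIdeal _ bot_ne_top]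
          exact (Ideal.span_singleton_le_iff_mem _).2 hxm
      exact hz ((Submodule.mem_bot R).1 (hU0 ▸ (hU z).2 hpz))
    -- The new prime `q` is associated to `M/xM` and contains both `p` and `x`, while `x ∉ p`. So `R
    -- ⧸ q` has smaller dimension than `R ⧸ p`, and the induction applies to `q`.
    obtain ⟨q, hq, hqle⟩ := exists_le_isAssociatedPrime_of_isNoetherianRing R _ hy
    have hqp : q.IsPrime := hq.isPrime
    obtain ⟨-, w, hw⟩ := isAssociatedPrime_iff.1 hq
    have hpq : p ≤ q := fun r hr => hqle (by
      rw [Submodule.mem_colon_singleton, ← Submodule.Quotient.mk_smul, (hU y).1 hyU r hr]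
      exact zero_mem _)
    have hxq : x ∈ q := hqle (by
      rw [Submodule.mem_colon_singleton, ← Submodule.Quotient.mk_smul, Submodule.mem_bot,
        Submodule.Quotient.mk_eq_zero]
      exact Submodule.smul_mem_pointwise_smul _ _ _ trivial)
    have hxp : x ∉ p := fun hxp => hz (hx ((hpz x hxp).trans (smul_zero x).symm))
    have h1 := ih ⟨xs, by simpa using hlen, fun r hr => hmem r (List.mem_cons_of_mem _ hr), hxs⟩
      q w (by
        rintro rfl
        refine hqp.ne_top (hw.trans ?_)
        simp) (fun r hr => by
        rw [hw, Submodule.mem_colon_singleton] at hr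
        exact hr)
    have h2 := ringKrullDim_succ_le_of_surjective (Ideal.Quotient.factor hpq)
      (Ideal.Quotient.factor_surjective hpq) (r := Ideal.Quotient.mk p x)
      (mem_nonZeroDivisors_of_ne_zero (by rwa [Ne, Ideal.Quotient.eq_zero_iff_mem]))
      (by rw [Ideal.Quotient.factor_mk, Ideal.Quotient.eq_zero_iff_mem]; exact hxq)
    refine le_trans ?_ h2
    push_cast
    gcongr

end Depth

/-! ### Heights in quotients and Macaulay's unmixedness theorem -/

section Unmixed

open IsLocalRing RingTheory.Sequence

universe u

variable {R : Type u} [CommRing R]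

/-- If all primes containing `I` have height at least `c`, heights drop by at least `c` in
`R ⧸ I`. -/
theorem height_quotient_le_of_forall_le_height [IsNoetherianRing R] {I : Ideal R} {c : ℕ}
    (hI : ∀ Q : Ideal R, Q.IsPrime → I ≤ Q → c ≤ Q.height) (k : ℕ) :
    ∀ (q : Ideal (R ⧸ I)) [q.IsPrime],
      (q.comap (Ideal.Quotient.mk I)).height ≤ (c + k : ℕ) → q.height ≤ k := by
  have key (q q' : Ideal (R ⧸ I)) (hq : q.IsPrime) (hq' : q'.IsPrime) (hlt : q' < q) :
      (q'.comap (Ideal.Quotient.mk I)).height + 1 ≤ (q.comap (Ideal.Quotient.mk I)).height ∧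
        c ≤ (q'.comap (Ideal.Quotient.mk I)).height := by
    refine ⟨Ideal.height_add_one_le_of_lt_of_isPrime ?_, hI _ inferInstance fun x hx => ?_⟩
    · exact (Ideal.comap_mono hlt.le).lt_of_ne fun h => hlt.ne
        (Ideal.comap_injective_of_surjective _ Ideal.Quotient.mk_surjective h)
    · rw [Ideal.mem_comap, Ideal.Quotient.eq_zero_iff_mem.2 hx]
      exact zero_mem _
  induction k with
  | zero =>
    intro q hq h
    rw [Ideal.height_le_iff]
    intro q' hq' hlt
    obtain ⟨h1, h2⟩ := key q q' hq hq' hlt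
    have h3 : ((c + 1 : ℕ) : ℕ∞) ≤ (c + 0 : ℕ) := by
      refine le_trans ?_ (h1.trans h)
      push_cast; gcongr
    exact absurd (ENat.natCast_le_natCast.1 h3) (by omega)
  | succ k ih =>
    intro q hq h
    rw [Ideal.height_le_iff]
    intro q' hq' hlt
    obtain ⟨h1, h2⟩ := key q q' hq hq' hlt
    have h3 := ih q' (by
      have h4 := h1.trans h
      rw [← Nat.add_assoc, Nat.cast_add (c + k) 1, Nat.cast_one] at h4
      exact (ENat.add_le_add_iff_right (by simp)).1 h4)
    exact lt_of_le_of_lt h3 (by exact_mod_cast Nat.lt_succ_self k)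

theorem ringKrullDim_quotient_le_of_forall_le_height [IsNoetherianRing R] {I : Ideal R} {c k : ℕ}
    (hI : ∀ Q : Ideal R, Q.IsPrime → I ≤ Q → c ≤ Q.height) (hk : ringKrullDim R ≤ (c + k : ℕ)) :
    ringKrullDim (R ⧸ I) ≤ k := by
  rw [ringKrullDim_le_iff_height_le]
  intro q hq
  have := height_quotient_le_of_forall_le_height hI k q (by
    have := (ringKrullDim_le_iff_height_le _).1 hk
      (inferInstance : (q.comap (Ideal.Quotient.mk I)).IsPrime)
    exact_mod_cast this)
  exact_mod_cast this

/-- In a regular local ring, `c` elements generating an ideal of height at least `c` form a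
regular sequence. -/
theorem isWeaklyRegular_of_forall_le_height [IsRegularLocalRing R] {xs : List R}
    (hmem : ∀ x ∈ xs, x ∈ maximalIdeal R)
    (hht : ∀ Q : Ideal R, Q.IsPrime → Ideal.ofList xs ≤ Q → xs.length ≤ Q.height) :
    IsWeaklyRegular R xs := by
  classical
  obtain ⟨-, hdepth⟩ := IsRegularLocalRing.isDomain_and_exists_isRegular _ R rfl
  have hdim := IsRegularLocalRing.spanFinrank_maximalIdeal (R := R)
  set n := (maximalIdeal R).spanFinrank
  have hcn : xs.length ≤ n := by
    have h1 := hht (maximalIdeal R) inferInstance (Ideal.span_le.2 hmem)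
    have h2 := IsLocalRing.maximalIdeal_height_eq_ringKrullDim (R := R)
    rw [← hdim] at h2
    have h3 : (maximalIdeal R).height = n := by exact_mod_cast h2
    rw [h3] at h1
    exact_mod_cast h1
  have hI := ringKrullDim_quotient_le_of_forall_le_height (k := n - xs.length) hht (by
    rw [← hdim, Nat.add_sub_cancel' hcn])
  suffices h : ∀ i ≤ xs.length, IsWeaklyRegular R (xs.take i) by
    simpa using h xs.length le_rfl
  intro i
  induction i with
  | zero => intro _; simp
  | succ i ih =>
    intro hi
    have hi' : i < xs.length := hi
    have hpre := ih hi'.le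
    rw [List.take_succ_eq_append_getElem hi', isWeaklyRegular_append_iff,
      isWeaklyRegular_singleton_iff]
    refine ⟨hpre, ?_⟩
    -- A zero divisor `xs[i]` lies in an associated prime `q` of the quotient by the first `i`
    -- elements, and depth gives `dim R/q ≥ n - i`. Killing the remaining `c - i - 1` elements, `c`
    -- being the length of `xs`, lowers the dimension by at most that number and ends below `n - c`:
    -- a contradiction.
    by_contra hreg
    have hdepth' := exists_isRegular_quotient (xs.take i) (M := R) (n := n - i) (by
      rw [List.length_take, min_eq_left hi'.le, Nat.sub_add_cancel (by omega)]
      exact hdepth) (fun x hx => hmem x (List.mem_of_mem_take hx)) hpre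
    set M := R ⧸ Ideal.ofList (xs.take i) • (⊤ : Submodule R R)
    obtain ⟨z, hz, hxz⟩ : ∃ z : M, z ≠ 0 ∧ xs[i] • z = 0 := by
      rw [isSMulRegular_iff_right_eq_zero_of_smul] at hreg
      push Not at hreg
      obtain ⟨z, h1, h2⟩ := hreg
      exact ⟨z, h2, h1⟩
    obtain ⟨q, hq, hqle⟩ := exists_le_isAssociatedPrime_of_isNoetherianRing R z hz
    have hqp : q.IsPrime := hq.isPrime
    obtain ⟨-, w, hw⟩ := isAssociatedPrime_iff.1 hq
    have hdq := length_le_ringKrullDim_quotient_of_smul_eq_zero _ hdepth' q w (by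
        rintro rfl
        refine hqp.ne_top (hw.trans ?_)
        simp) (fun r hr => by
        rw [hw, Submodule.mem_colon_singleton] at hr
        exact hr)
    have hq1 : Ideal.ofList (xs.take (i + 1)) ≤ q := by
      rw [List.take_succ_eq_append_getElem hi', Ideal.ofList_append, Ideal.ofList_singleton]
      refine sup_le (fun r hr => hqle ?_) ((Ideal.span_singleton_le_iff_mem _).2 (hqle ?_))
      · rw [Submodule.mem_colon_singleton, Submodule.mem_bot]
        obtain ⟨z, rfl⟩ := Submodule.Quotient.mk_surjective _ z
        rw [← Submodule.Quotient.mk_smul, Submodule.Quotient.mk_eq_zero]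
        exact Submodule.smul_mem_smul hr trivial
      · rw [Submodule.mem_colon_singleton, hxz]; exact zero_mem _
    let s : Finset (R ⧸ q) := ((xs.drop (i + 1)).map (Ideal.Quotient.mk q)).toFinset
    have : IsLocalRing (R ⧸ q) :=
      have : Nontrivial (R ⧸ q) := Ideal.Quotient.nontrivial_iff.2 hqp.ne_top
      IsLocalRing.of_surjective' _ Ideal.Quotient.mk_surjective
    have hl : IsLocalHom (Ideal.Quotient.mk q) :=
      IsLocalHom.of_surjective _ Ideal.Quotient.mk_surjective
    have h1 := ringKrullDim_le_ringKrullDim_quotient_add_card s (by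
      rw [IsLocalRing.ringJacobson_eq_maximalIdeal]
      intro b hb
      simp only [s, List.coe_toFinset, Set.mem_ofPred_eq, List.mem_map] at hb
      obtain ⟨a, ha, rfl⟩ := hb
      have hle : maximalIdeal R ≤ (maximalIdeal (R ⧸ q)).comap (Ideal.Quotient.mk q) :=
        ((local_hom_TFAE (Ideal.Quotient.mk q)).out 0 3).1 hl
      exact hle (hmem a (List.mem_of_mem_drop ha)))
    have h2 : ringKrullDim ((R ⧸ q) ⧸ Ideal.span (s : Set (R ⧸ q))) ≤
        ringKrullDim (R ⧸ Ideal.ofList xs) := by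
      refine ringKrullDim_le_of_surjective (Ideal.Quotient.lift (Ideal.ofList xs)
        ((Ideal.Quotient.mk (Ideal.span (s : Set (R ⧸ q)))).comp (Ideal.Quotient.mk q)) ?_) ?_
      · intro a ha
        rw [← RingHom.mem_ker]
        revert a
        change Ideal.ofList xs ≤ _
        rw [← List.take_append_drop (i + 1) xs, Ideal.ofList_append]
        refine sup_le (fun a ha => ?_) (Ideal.span_le.2 fun a ha => ?_)
        · rw [RingHom.mem_ker, RingHom.comp_apply, Ideal.Quotient.eq_zero_iff_mem.2 (hq1 ha),
            map_zero]
        · rw [SetLike.mem_coe, RingHom.mem_ker, RingHom.comp_apply, Ideal.Quotient.eq_zero_iff_mem]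
          refine Ideal.subset_span ?_
          simp only [s, List.coe_toFinset, Set.mem_ofPred_eq, List.mem_map]
          exact ⟨a, ha, rfl⟩
      · refine Ideal.Quotient.lift_surjective_of_surjective _ _ ?_
        exact Ideal.Quotient.mk_surjective.comp Ideal.Quotient.mk_surjective
    have h3 : s.card ≤ xs.length - (i + 1) :=
      (List.toFinset_card_le _).trans (by simp)
    have h4 : ((n - i : ℕ) : WithBot ℕ∞) ≤ ((n - xs.length + (xs.length - (i + 1)) : ℕ) :) := by
      refine (hdq.trans h1).trans ?_
      push_cast
      gcongr
      exact h2.trans hI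
    have h5 : n - i ≤ n - xs.length + (xs.length - (i + 1)) := by exact_mod_cast h4
    omega

/-- **Macaulay's unmixedness theorem** in a localization of a regular ring: if `c` elements generate
an ideal all of whose primes have height at least `c`, every prime of the form `(I : y)` has
height `c`. -/
theorem height_eq_length_of_colon [IsRegularRing R] {xs : List R}
    (hht : ∀ Q : Ideal R, Q.IsPrime → Ideal.ofList xs ≤ Q → xs.length ≤ Q.height)
    {Q : Ideal R} [Q.IsPrime] {y : R} (hQy : ∀ r, r ∈ Q ↔ r * y ∈ Ideal.ofList xs) :
    Q.height = xs.length := by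
  have hle : Ideal.ofList xs ≤ Q := fun x hx => (hQy x).2 (Ideal.mul_mem_right _ _ hx)
  refine le_antisymm ?_ (hht Q inferInstance hle)
  by_contra! hlt
  let A := Localization.AtPrime Q
  have hA : IsRegularLocalRing A := IsRegularRing.isRegularLocalRing_localization Q
  obtain ⟨-, hdepth⟩ := IsRegularLocalRing.isDomain_and_exists_isRegular
    (maximalIdeal A).spanFinrank A rfl
  have hdim : ((maximalIdeal A).spanFinrank : ℕ∞) = Q.height := by
    have h1 := IsRegularLocalRing.spanFinrank_maximalIdeal (R := A)
    rw [IsLocalization.AtPrime.ringKrullDim_eq_height Q A] at h1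
    exact_mod_cast h1
  have hxm : ∀ x ∈ xs.map (algebraMap R A), x ∈ maximalIdeal A := by
    intro x hx
    obtain ⟨a, ha, rfl⟩ := List.mem_map.1 hx
    exact (IsLocalization.AtPrime.to_map_mem_maximal_iff A Q a).2 (hle (Ideal.subset_span ha))
  have hwr : RingTheory.Sequence.IsWeaklyRegular A (xs.map (algebraMap R A)) := by
    refine isWeaklyRegular_of_forall_le_height hxm fun P hP hPle => ?_
    rw [List.length_map, ← IsLocalization.height_under Q.primeCompl P]
    refine hht _ inferInstance ?_
    rwa [← Ideal.map_ofList, Ideal.map_le_iff_le_comap] at hPle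
  have hlt' : xs.length < (maximalIdeal A).spanFinrank := by
    rw [← hdim] at hlt
    exact_mod_cast hlt
  obtain ⟨k, hk⟩ := Nat.exists_eq_add_of_lt hlt'
  -- If the height exceeded the number of elements, the quotient of the localization would have a
  -- regular element `z` in the maximal ideal. But `z` kills the class of `y`, so that class would
  -- vanish locally, against `Q = (I : y)`.
  obtain ⟨rs, hlen, hmem, hrs⟩ := exists_isRegular_quotient (xs.map (algebraMap R A))
    (M := A) (n := k + 1) (by
      rw [List.length_map, show k + 1 + xs.length = (maximalIdeal A).spanFinrank by omega]
      exact hdepth) hxm hwr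
  obtain ⟨z, zs, rfl⟩ := List.exists_cons_of_length_eq_add_one hlen
  have hreg := ((isRegular_cons_iff _ z zs).1 hrs).1
  have hz := hmem z List.mem_cons_self
  have hI : Ideal.ofList (xs.map (algebraMap R A)) • (⊤ : Submodule A A) =
      (Ideal.ofList xs).map (algebraMap R A) := by
    rw [Ideal.map_ofList, smul_eq_mul, Ideal.mul_top]
  have hy0 : z • (Submodule.Quotient.mk (algebraMap R A y) :
      A ⧸ Ideal.ofList (xs.map (algebraMap R A)) • (⊤ : Submodule A A)) = 0 := by
    rw [← Submodule.Quotient.mk_smul, Submodule.Quotient.mk_eq_zero, hI]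
    obtain ⟨a, s, rfl⟩ := IsLocalization.exists_mk'_eq Q.primeCompl z
    have ha : a ∈ Q := (IsLocalization.AtPrime.mk'_mem_maximal_iff A Q a s).1 hz
    rw [smul_eq_mul, IsLocalization.mk'_eq_mul_mk'_one, mul_right_comm, ← map_mul]
    exact Ideal.mul_mem_right _ _ (Ideal.mem_map_of_mem _ ((hQy a).1 ha))
  have hy1 := hreg (hy0.trans (smul_zero z).symm)
  rw [Submodule.Quotient.mk_eq_zero, hI] at hy1
  obtain ⟨s, hs, hsy⟩ := (IsLocalization.algebraMap_mem_map_algebraMap_iff Q.primeCompl A _ _).1 hy1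
  exact hs ((hQy s).2 hsy)

end Unmixed

/-! ### Differentials of polynomials at field-valued points -/

section Gradient

open IsLocalRing MvPolynomial

variable {σ k K : Type*} [Field k] [Field K]

/-- The gradient of a polynomial, evaluated through a ring homomorphism to a field. -/
noncomputable def polyGrad (φ : MvPolynomial σ k →+* K) (F : MvPolynomial σ k) : σ → K :=
  fun c => φ (pderiv c F)

variable (φ : MvPolynomial σ k →+* K)

theorem polyGrad_add (F G : MvPolynomial σ k) :
    polyGrad φ (F + G) = polyGrad φ F + polyGrad φ G := by
  ext c; simp [polyGrad]

theorem polyGrad_zero : polyGrad φ 0 = 0 := by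
  ext c; simp [polyGrad]

theorem polyGrad_mul (F G : MvPolynomial σ k) :
    polyGrad φ (F * G) = φ F • polyGrad φ G + φ G • polyGrad φ F := by
  ext c; simp [polyGrad, Derivation.leibniz]

theorem polyGrad_sum {ι : Type*} (s : Finset ι) (F : ι → MvPolynomial σ k) :
    polyGrad φ (∑ i ∈ s, F i) = ∑ i ∈ s, polyGrad φ (F i) := by
  ext c; simp [polyGrad]

theorem polyGrad_X [DecidableEq σ] (c : σ) : polyGrad φ (X c) = Pi.single c 1 := by
  ext d
  by_cases h : c = d
  · subst h; simp [polyGrad]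
  · simp [polyGrad, pderiv_X_of_ne h, Pi.single_eq_of_ne (Ne.symm h)]

theorem polyGrad_C (a : k) : polyGrad φ (C a) = 0 := by
  ext d; simp [polyGrad]

variable {φ}

/-- By the Leibniz rule, at a point where the generators vanish, the terms that differentiate the
coefficients disappear. -/
theorem polyGrad_mem_span_of_mem_span {Z : Set (MvPolynomial σ k)} (hZ : ∀ z ∈ Z, φ z = 0)
    {F : MvPolynomial σ k} (hF : F ∈ Ideal.span Z) :
    polyGrad φ F ∈ Submodule.span K (polyGrad φ '' Z) := by
  have hle : Ideal.span Z ≤ RingHom.ker φ := Ideal.span_le.2 hZ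
  induction hF using Submodule.span_induction with
  | mem x hx => exact Submodule.subset_span ⟨x, hx, rfl⟩
  | zero => rw [polyGrad_zero]; exact zero_mem _
  | add x y _ _ hx hy => rw [polyGrad_add]; exact add_mem hx hy
  | smul a x hx h =>
    have h0 : φ x = 0 := hle hx
    rw [smul_eq_mul, polyGrad_mul, h0, zero_smul, add_zero]
    exact Submodule.smul_mem _ _ h

/-- Gradients of elements of the kernel lie in the span of the gradients of local generators. -/
theorem polyGrad_mem_span_of_mul_mem {Z : Set (MvPolynomial σ k)} (hZ : ∀ z ∈ Z, φ z = 0)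
    {F s : MvPolynomial σ k} (hF : φ F = 0) (hs : φ s ≠ 0) (hsF : s * F ∈ Ideal.span Z) :
    polyGrad φ F ∈ Submodule.span K (polyGrad φ '' Z) := by
  have h := polyGrad_mem_span_of_mem_span hZ hsF
  rw [polyGrad_mul, hF, zero_smul, add_zero] at h
  exact (Submodule.smul_mem_iff _ hs).1 h

theorem polyGrad_eq_zero_of_mem_sq {F : MvPolynomial σ k} (hF : F ∈ RingHom.ker φ ^ 2) :
    polyGrad φ F = 0 := by
  rw [pow_two] at hF
  induction hF using Submodule.mul_induction_on' with
  | mem_mul_mem x hx y hy =>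
    rw [polyGrad_mul, (hx : φ x = 0), (hy : φ y = 0), zero_smul, zero_smul, add_zero]
  | add x _ y _ hx hy => rw [polyGrad_add, hx, hy, add_zero]

end Gradient

/-! ### Generators of a prime in its localization, and the height against the rank of differentials
-/

section LocalGenerators

open IsLocalRing

variable {R : Type*} [CommRing R]

/-- The maximal ideal of a Noetherian local ring at `P` is generated by as few elements of `P` as
possible. -/
theorem exists_finset_generators_localization [IsNoetherianRing R] (P : Ideal R) [P.IsPrime] :
    ∃ Z : Finset R, Z.card ≤ (maximalIdeal (Localization.AtPrime P)).spanFinrank ∧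
      (∀ z ∈ Z, z ∈ P) ∧ ∀ F ∈ P, ∃ s ∉ P, s * F ∈ Ideal.span (Z : Set R) := by
  classical
  let A := Localization.AtPrime P
  obtain ⟨s, hcard, hspan⟩ :=
    (IsNoetherian.noetherian (maximalIdeal A)).exists_span_finset_card_eq_spanFinrank
  have hsm : ∀ a ∈ s, a ∈ maximalIdeal A := fun a ha => hspan ▸ Submodule.subset_span ha
  -- Denominators are units in the localization, so the numerators generate the same ideal.
  choose num den hnd using fun a : A => IsLocalization.exists_mk'_eq P.primeCompl a
  refine ⟨s.image num, hcard ▸ Finset.card_image_le, ?_, fun F hF => ?_⟩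
  · intro z hz
    obtain ⟨a, ha, rfl⟩ := Finset.mem_image.1 hz
    have := hsm a ha
    rw [← hnd a] at this
    exact (IsLocalization.AtPrime.mk'_mem_maximal_iff A P _ _).1 this
  · have h1 : algebraMap R A F ∈ (Ideal.span (s.image num : Set R)).map (algebraMap R A) := by
      have h2 : algebraMap R A F ∈ Submodule.span A (s : Set A) :=
        hspan ▸ (IsLocalization.AtPrime.to_map_mem_maximal_iff A P F).2 hF
      refine (Submodule.span_le (p := (Ideal.span (s.image num : Set R)).map
        (algebraMap R A))).2 (fun a ha => ?_) h2
      rw [SetLike.mem_coe, ← hnd a, IsLocalization.mk'_eq_mul_mk'_one]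
      exact Ideal.mul_mem_right _ _ (Ideal.mem_map_of_mem _ (Ideal.subset_span
        (Finset.mem_coe.2 (Finset.mem_image_of_mem _ ha))))
    obtain ⟨t, ht, htF⟩ :=
      (IsLocalization.algebraMap_mem_map_algebraMap_iff P.primeCompl A _ _).1 h1
    exact ⟨t, ht, htF⟩

theorem maximalIdeal_eq_map_of_forall_mul_mem (P J : Ideal R) [P.IsPrime] (hJ : J ≤ P)
    (h : ∀ F ∈ P, ∃ s ∉ P, s * F ∈ J) :
    maximalIdeal (Localization.AtPrime P) = J.map (algebraMap R (Localization.AtPrime P)) := by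
  rw [← Localization.AtPrime.map_eq_maximalIdeal]
  refine le_antisymm (Ideal.map_le_iff_le_comap.2 fun F hF => ?_) (Ideal.map_mono hJ)
  obtain ⟨s, hs, hsF⟩ := h F hF
  rw [Ideal.mem_comap, IsLocalization.algebraMap_mem_map_algebraMap_iff P.primeCompl]
  exact ⟨s, hs, hsF⟩

end LocalGenerators

section PolynomialRing

open IsLocalRing MvPolynomial

variable {σ k K : Type*} [Finite σ] [Field k] [Field K] {φ : MvPolynomial σ k →+* K}

theorem spanFinrank_maximalIdeal_localization_eq_height (P : Ideal (MvPolynomial σ k))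
    [P.IsPrime] : ((maximalIdeal (Localization.AtPrime P)).spanFinrank : ℕ∞) = P.height := by
  have : IsRegularLocalRing (Localization.AtPrime P) :=
    IsRegularRing.isRegularLocalRing_localization P
  have h1 := IsRegularLocalRing.spanFinrank_maximalIdeal (R := Localization.AtPrime P)
  rw [IsLocalization.AtPrime.ringKrullDim_eq_height P] at h1
  exact_mod_cast h1

/-- The height of a prime is at least the rank of the differentials of its elements. -/
theorem finrank_span_polyGrad_le_height :
    (Module.finrank K (Submodule.span K (polyGrad φ '' (RingHom.ker φ : Set _))) : ℕ∞) ≤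
      (RingHom.ker φ).height := by
  have : (RingHom.ker φ).IsPrime := RingHom.ker_isPrime φ
  obtain ⟨Z, hcard, hZ, hgen⟩ := exists_finset_generators_localization (RingHom.ker φ)
  rw [← spanFinrank_maximalIdeal_localization_eq_height]
  refine le_trans ?_ (Nat.cast_le.2 hcard)
  have hle : Submodule.span K (polyGrad φ '' (RingHom.ker φ : Set _)) ≤
      Submodule.span K (polyGrad φ '' (Z : Set _)) := by
    refine Submodule.span_le.2 ?_
    rintro _ ⟨F, hF, rfl⟩
    obtain ⟨s, hs, hsF⟩ := hgen F hF
    exact polyGrad_mem_span_of_mul_mem hZ hF hs hsF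
  have hfin := Fintype.ofFinite σ
  classical
  refine Nat.cast_le.2 ((Submodule.finrank_mono hle).trans ?_)
  rw [← Finset.coe_image]
  exact (finrank_span_finset_le_card _).trans Finset.card_image_le

/-- Elements of a prime with independent differentials generate it locally as soon as their number
is the height. -/
theorem exists_mul_mem_span_of_linearIndependent {ι : Type*} [Fintype ι]
    (z : ι → MvPolynomial σ k) (hz : ∀ i, φ (z i) = 0)
    (hli : LinearIndependent K fun i => polyGrad φ (z i))
    (hcard : (RingHom.ker φ).height = Fintype.card ι) {F : MvPolynomial σ k} (hF : φ F = 0) :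
    ∃ s, φ s ≠ 0 ∧ s * F ∈ Ideal.span (Set.range z) := by
  have hP : (RingHom.ker φ).IsPrime := RingHom.ker_isPrime φ
  set P := RingHom.ker φ with hPdef
  let A := Localization.AtPrime P
  have hA : IsRegularLocalRing A := IsRegularRing.isRegularLocalRing_localization P
  have hzm (i : ι) : algebraMap _ A (z i) ∈ maximalIdeal A :=
    (IsLocalization.AtPrime.to_map_mem_maximal_iff A P _).2 (hz i)
  let v : ι → CotangentSpace A := fun i => (maximalIdeal A).toCotangent ⟨_, hzm i⟩
  -- Gradients vanish on `P²`, so a relation modulo the square of the maximal ideal becomes, once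
  -- denominators are cleared, a relation between the gradients. Independence in the cotangent space
  -- then turns into generation by a dimension count and Nakayama.
  have hv : LinearIndependent (ResidueField A) v := by
    rw [Fintype.linearIndependent_iff]
    intro c hc
    choose a ha using fun i => IsLocalRing.residue_surjective (c i)
    have h1 : ∑ i, a i * algebraMap _ A (z i) ∈ maximalIdeal A ^ 2 := by
      have h2 : (maximalIdeal A).toCotangent (∑ i, a i • ⟨_, hzm i⟩) = 0 := by
        rw [map_sum, ← hc]
        refine Finset.sum_congr rfl fun i _ => ?_
        rw [map_smul, ← ha i]
        rfl
      rw [Ideal.toCotangent_eq_zero] at h2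
      convert h2 using 1
      simp
    obtain ⟨⟨b, hb⟩, hint⟩ := IsLocalization.exist_integer_multiples_of_finite P.primeCompl a
    choose r hr using hint
    have h3 : algebraMap _ A (∑ i, r i * z i) ∈ (P ^ 2).map (algebraMap _ A) := by
      rw [Ideal.map_pow, Localization.AtPrime.map_eq_maximalIdeal, map_sum]
      have : ∑ i, algebraMap _ A (r i * z i) =
          algebraMap _ A b * ∑ i, a i * algebraMap _ A (z i) := by
        rw [Finset.mul_sum]
        refine Finset.sum_congr rfl fun i _ => ?_
        rw [map_mul, hr i, Algebra.smul_def, mul_assoc]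
      rw [this]
      exact Ideal.mul_mem_left _ _ h1
    obtain ⟨t, ht, h4⟩ :=
      (IsLocalization.algebraMap_mem_map_algebraMap_iff P.primeCompl A _ _).1 h3
    have h5 := polyGrad_eq_zero_of_mem_sq h4
    have h6 : φ (∑ i, r i * z i) = 0 := by simp [hz]
    have ht' : φ t ≠ 0 := ht
    rw [polyGrad_mul, h6, zero_smul, add_zero, smul_eq_zero_iff_right ht', polyGrad_sum] at h5
    simp only [polyGrad_mul, hz, zero_smul, add_zero] at h5
    intro i
    have h7 : r i ∈ P := (Fintype.linearIndependent_iff.1 hli) _ h5 i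
    have h8 := (IsLocalization.AtPrime.to_map_mem_maximal_iff A P _).2 h7
    rw [hr i, Algebra.smul_def] at h8
    have hbu : IsUnit (algebraMap _ A b) := IsLocalization.map_units A (⟨b, hb⟩ : P.primeCompl)
    rw [← ha i, residue_eq_zero_iff]
    exact (Ideal.unit_mul_mem_iff_mem _ hbu).1 h8
  have hfr : Fintype.card ι = Module.finrank (ResidueField A) (CotangentSpace A) := by
    have h1 := spanFinrank_maximalIdeal_localization_eq_height P
    rw [hcard, spanFinrank_maximalIdeal_eq_finrank_cotangentSpace] at h1
    exact_mod_cast h1.symm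
  have hspan := hv.span_eq_top_of_card_eq_finrank' hfr
  have hr : Set.range v =
      (maximalIdeal A).toCotangent '' Set.range (fun i => (⟨_, hzm i⟩ : maximalIdeal A)) := by
    rw [← Set.range_comp]; rfl
  rw [hr, CotangentSpace.span_image_eq_top_iff] at hspan
  have hF' : (⟨_, (IsLocalization.AtPrime.to_map_mem_maximal_iff A P F).2 hF⟩ : maximalIdeal A) ∈
      Submodule.span A (Set.range (fun i => (⟨_, hzm i⟩ : maximalIdeal A))) := hspan ▸ trivial
  have h1 := Submodule.mem_map_of_mem (f := (maximalIdeal A).subtype) hF'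
  rw [Submodule.map_span, ← Set.range_comp] at h1
  have h2 : algebraMap _ A F ∈ (Ideal.span (Set.range z)).map (algebraMap _ A) := by
    rw [Ideal.map_span, ← Set.range_comp]
    exact h1
  obtain ⟨t, ht, h3⟩ := (IsLocalization.algebraMap_mem_map_algebraMap_iff P.primeCompl A _ _).1 h2
  exact ⟨t, ht, h3⟩

end PolynomialRing

/-! ### Syzygies of bounded degree of a coprime triple -/

section Syzygies

open Polynomial

variable {K : Type*} [Field K]

theorem degree_mul_lt_of_lt {p q : K[X]} {m n : ℕ} (hp : p.degree < m)
    (hq : q.degree < (n + 1 : ℕ)) :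
    (p * q).degree < (m + n : ℕ) := by
  by_cases hp0 : p = 0
  · simp [hp0]
  by_cases hq0 : q = 0
  · simp [hq0]
  rw [degree_mul, degree_eq_natDegree hp0, degree_eq_natDegree hq0]
  rw [degree_eq_natDegree hp0] at hp
  rw [degree_eq_natDegree hq0] at hq
  have h1 : p.natDegree < m := by exact_mod_cast hp
  have h2 : q.natDegree < n + 1 := by exact_mod_cast hq
  exact_mod_cast (by omega : p.natDegree + q.natDegree < m + n)

/-- The linear map `(a, b, c) ↦ w a + 2 v b + u c` on polynomials of bounded degree. -/
noncomputable def syzygyMap (n : ℕ) (u v w : K[X]) :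
    (degreeLT K n × degreeLT K n × degreeLT K (n + 1)) →ₗ[K] K[X] :=
  (LinearMap.mulLeft K w ∘ₗ (degreeLT K n).subtype).coprod
    ((LinearMap.mulLeft K (2 * v) ∘ₗ (degreeLT K n).subtype).coprod
      (LinearMap.mulLeft K u ∘ₗ (degreeLT K (n + 1)).subtype))

theorem syzygyMap_apply (n : ℕ) (u v w : K[X])
    (x : degreeLT K n × degreeLT K n × degreeLT K (n + 1)) :
    syzygyMap n u v w x = w * x.1 + (2 * v * x.2.1 + u * x.2.2) := rfl

/-- Multiply the Bézout identity by `q`, reduce the multipliers of `v` and `w` modulo `u`, and let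
the multiplier of `u` absorb the quotients. Its degree bound then follows by comparing degrees, as
`u` is monic. -/
theorem exists_syzygyMap_eq (h2 : (2 : K) ≠ 0) {n : ℕ} {u v w α β γ : K[X]} (hu : u.Monic)
    (hun : u.natDegree = n) (hv : v.degree < n) (hw : w.degree < (n + 2 : ℕ))
    (hb : α * u + β * v + γ * w = 1) {q : K[X]} (hq : q.degree < (2 * n + 1 : ℕ)) :
    ∃ x, syzygyMap n u v w x = q := by
  have hud : u.degree = n := by rw [degree_eq_natDegree hu.ne_zero, hun]
  have ha : ((γ * q) %ₘ u).degree < n := hud ▸ degree_modByMonic_lt _ hu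
  have hb' : ((β * q) %ₘ u).degree < n := hud ▸ degree_modByMonic_lt _ hu
  have hb2 : (C (2⁻¹ : K) * ((β * q) %ₘ u)).degree < n :=
    lt_of_le_of_lt (by
      rw [degree_mul, degree_C (inv_ne_zero h2), zero_add]) hb'
  set a := (γ * q) %ₘ u with ha_def
  set b := (β * q) %ₘ u with hb_def
  set c := α * q + w * ((γ * q) /ₘ u) + v * ((β * q) /ₘ u) with hc_def
  have e1 : a + u * ((γ * q) /ₘ u) = γ * q := modByMonic_add_div _ _
  have e2 : b + u * ((β * q) /ₘ u) = β * q := modByMonic_add_div _ _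
  have e3 : u * c = q - w * a - v * b := by
    have : α * u * q + β * v * q + γ * w * q = q := by rw [← add_mul, ← add_mul, hb, one_mul]
    rw [hc_def]
    linear_combination this + w * e1 + v * e2
  have e4 : (u * c).degree < (2 * n + 1 : ℕ) := by
    rw [e3]
    refine lt_of_le_of_lt (degree_sub_le _ _) (max_lt ?_ ?_)
    · refine lt_of_le_of_lt (degree_sub_le _ _) (max_lt hq ?_)
      rw [mul_comm]
      have := degree_mul_lt_of_lt (n := n + 1) ha hw
      rwa [show n + (n + 1) = 2 * n + 1 by ring] at this
    · refine lt_of_lt_of_le (degree_mul_lt_of_lt (n := n) hv (hb'.trans ?_)) ?_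
      · exact_mod_cast Nat.lt_succ_self n
      · exact_mod_cast (by omega : n + n ≤ 2 * n + 1)
  have hc : c.degree < (n + 1 : ℕ) := by
    by_cases hc0 : c = 0
    · simp [hc0]
    rw [degree_mul, hud, degree_eq_natDegree hc0] at e4
    have : n + c.natDegree < 2 * n + 1 := by exact_mod_cast e4
    rw [degree_eq_natDegree hc0]
    exact_mod_cast (by omega : c.natDegree < n + 1)
  -- The factor `2⁻¹` compensates for the `2` in `2 v b`, the derivative of `v²`.
  refine ⟨(⟨a, mem_degreeLT.2 ha⟩, ⟨C (2⁻¹ : K) * b, mem_degreeLT.2 hb2⟩,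
    ⟨c, mem_degreeLT.2 hc⟩), ?_⟩
  rw [syzygyMap_apply]
  have h22 : (2 : K[X]) * C (2⁻¹ : K) = 1 := by
    rw [show (2 : K[X]) = C 2 from rfl, ← C_mul, mul_inv_cancel₀ h2, C_1]
  simp only
  rw [e3]
  linear_combination (v * b) * h22

/-- Rank-nullity: the source has dimension `3n+1` and the image contains all polynomials of degree
at most `2n`. -/
theorem finrank_ker_syzygyMap_le (h2 : (2 : K) ≠ 0) {n : ℕ} {u v w α β γ : K[X]} (hu : u.Monic)
    (hun : u.natDegree = n) (hv : v.degree < n) (hw : w.degree < (n + 2 : ℕ))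
    (hb : α * u + β * v + γ * w = 1) :
    Module.finrank K (LinearMap.ker (syzygyMap n u v w)) ≤ n := by
  have h1 (m : ℕ) : Module.finrank K (degreeLT K m) = m := by
    rw [LinearEquiv.finrank_eq (degreeLTEquiv K m), Module.finrank_fin_fun]
  have hf (m : ℕ) : Module.Finite K (degreeLT K m) :=
    Module.Finite.equiv (degreeLTEquiv K m).symm
  have h3 : degreeLT K (2 * n + 1) ≤ LinearMap.range (syzygyMap n u v w) := fun q hq =>
    exists_syzygyMap_eq h2 hu hun hv hw hb (mem_degreeLT.1 hq)
  have h4 := Submodule.finrank_mono h3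
  have h5 := LinearMap.finrank_range_add_finrank_ker (syzygyMap n u v w)
  rw [Module.finrank_prod, Module.finrank_prod, h1, h1] at h5
  rw [h1] at h4
  omega

end Syzygies

namespace Mumford

open Polynomial

/-! ### Derivations along tangent vectors and the differential of the moment map -/

section Tangent

variable {g : ℕ} {K : Type*} [Field K] (φ : MvPolynomial (Coord g) ℂ →+* K) (t : Coord g → K)

/-- The derivation along the tangent vector `t`. -/
noncomputable def tangentDeriv : MvPolynomial (Coord g) ℂ →+ K where
  toFun F := ∑ c, t c * polyGrad φ F c
  map_zero' := by simp [polyGrad_zero]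
  map_add' F G := by simp [polyGrad_add, mul_add, Finset.sum_add_distrib]

theorem tangentDeriv_apply (F) : tangentDeriv φ t F = ∑ c, t c * polyGrad φ F c := rfl

theorem tangentDeriv_mul (F G) :
    tangentDeriv φ t (F * G) = φ F * tangentDeriv φ t G + φ G * tangentDeriv φ t F := by
  simp only [tangentDeriv_apply, polyGrad_mul, Finset.mul_sum, ← Finset.sum_add_distrib]
  refine Finset.sum_congr rfl fun c _ => ?_
  simp only [Pi.add_apply, Pi.smul_apply, smul_eq_mul]
  ring

theorem tangentDeriv_C (a : ℂ) : tangentDeriv φ t (MvPolynomial.C a) = 0 := by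
  simp [tangentDeriv_apply, polyGrad_C]

theorem tangentDeriv_X (c) : tangentDeriv φ t (MvPolynomial.X c) = t c := by
  classical
  simp [tangentDeriv_apply, polyGrad_X, Pi.single_apply]

theorem tangentDeriv_one : tangentDeriv φ t 1 = 0 := by
  rw [← map_one MvPolynomial.C, tangentDeriv_C]

/-- Variation of `u(x)` along `t`. -/
noncomputable def uVar : K[X] := ∑ i : Fin g, C (t (.inl i)) * X ^ (i : ℕ)

/-- Variation of `v(x)` along `t`. -/
noncomputable def vVar : K[X] := ∑ i : Fin g, C (t (.inr (.inl i))) * X ^ (i : ℕ)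

/-- Variation of `w(x)` along `t`. -/
noncomputable def wVar : K[X] := ∑ i : Fin (g + 1), C (t (.inr (.inr i))) * X ^ (i : ℕ)

theorem coeff_sum_fin {S : Type*} [Semiring S] {n : ℕ} (f : Fin n → S) (j : ℕ) :
    (∑ i : Fin n, C (f i) * X ^ (i : ℕ)).coeff j = if h : j < n then f ⟨j, h⟩ else 0 := by
  rw [finsetSum_coeff]
  simp only [coeff_C_mul_X_pow]
  split_ifs with h
  · rw [Finset.sum_eq_single (⟨j, h⟩ : Fin n)]
    · simp
    · intro b _ hb
      rw [if_neg]
      rintro rfl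
      exact hb rfl
    · simp
  · refine Finset.sum_eq_zero fun b _ => if_neg ?_
    rintro rfl
    exact h b.2

theorem degree_sum_fin_lt {S : Type*} [Semiring S] {n : ℕ} (f : Fin n → S) :
    (∑ i : Fin n, C (f i) * X ^ (i : ℕ)).degree < (n : WithBot ℕ) := by
  rw [degree_lt_iff_coeff_zero]
  intro m hm
  rw [coeff_sum_fin, dif_neg (not_lt.2 hm)]

theorem tangentDeriv_coeff_X_pow (n j : ℕ) :
    tangentDeriv φ t ((X ^ n : (MvPolynomial (Coord g) ℂ)[X]).coeff j) = 0 := by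
  rw [coeff_X_pow]
  split_ifs
  · exact tangentDeriv_one φ t
  · exact map_zero _

theorem tangentDeriv_coeff_uPoly (j : ℕ) :
    tangentDeriv φ t ((uPoly MvPolynomial.X).coeff j) = (uVar t).coeff j := by
  rw [uPoly, uVar, coeff_add, map_add, tangentDeriv_coeff_X_pow, zero_add, coeff_sum_fin,
    coeff_sum_fin]
  split_ifs
  · exact tangentDeriv_X φ t _
  · exact map_zero _

theorem tangentDeriv_coeff_vPoly (j : ℕ) :
    tangentDeriv φ t ((vPoly MvPolynomial.X).coeff j) = (vVar t).coeff j := by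
  rw [vPoly, vVar, coeff_sum_fin, coeff_sum_fin]
  split_ifs
  · exact tangentDeriv_X φ t _
  · exact map_zero _

theorem tangentDeriv_coeff_wPoly (j : ℕ) :
    tangentDeriv φ t ((wPoly MvPolynomial.X).coeff j) = (wVar t).coeff j := by
  rw [wPoly, wVar, coeff_add, map_add, tangentDeriv_coeff_X_pow, zero_add, coeff_sum_fin,
    coeff_sum_fin]
  split_ifs
  · exact tangentDeriv_X φ t _
  · exact map_zero _

theorem momentMap_eq {R : Type} [CommRing R] (a : Coord g → R) :
    momentMap a = vPoly a ^ 2 + uPoly a * wPoly a := by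
  rw [momentMap, polyMatrix, Matrix.det_fin_two]
  simp
  ring

variable {φ} in
theorem tangentDeriv_coeff_mul {p q : (MvPolynomial (Coord g) ℂ)[X]} {p' q' : K[X]}
    (hp : ∀ j, tangentDeriv φ t (p.coeff j) = p'.coeff j)
    (hq : ∀ j, tangentDeriv φ t (q.coeff j) = q'.coeff j) (j : ℕ) :
    tangentDeriv φ t ((p * q).coeff j) = (p.map φ * q' + q.map φ * p').coeff j := by
  rw [coeff_mul, map_sum, coeff_add, mul_comm (q.map φ), coeff_mul, coeff_mul,
    ← Finset.sum_add_distrib]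
  refine Finset.sum_congr rfl fun x _ => ?_
  rw [tangentDeriv_mul, hp, hq, coeff_map, coeff_map]
  ring

/-- The differential of the moment map. -/
theorem tangentDeriv_hFun (i : ℕ) :
    tangentDeriv φ t (hFun g i) =
      (2 * (vPoly MvPolynomial.X).map φ * vVar t + (uPoly MvPolynomial.X).map φ * wVar t +
        (wPoly MvPolynomial.X).map φ * uVar t).coeff i := by
  rw [hFun, momentMap_eq, pow_two, coeff_add, map_add,
    tangentDeriv_coeff_mul t (tangentDeriv_coeff_vPoly φ t) (tangentDeriv_coeff_vPoly φ t),
    tangentDeriv_coeff_mul t (tangentDeriv_coeff_uPoly φ t) (tangentDeriv_coeff_wPoly φ t),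
    ← coeff_add]
  congr 1
  ring

variable {φ t} in
/-- Divisibility by a constant polynomial passes to variations. -/
theorem map_dvd_of_tangentDeriv (ht : ∀ F, φ F = 0 → tangentDeriv φ t F = 0) {d : ℂ[X]}
    (hd : d.Monic) {p : (MvPolynomial (Coord g) ℂ)[X]} {p' : K[X]}
    (hp : ∀ j, tangentDeriv φ t (p.coeff j) = p'.coeff j)
    (hdvd : d.map (φ.comp MvPolynomial.C) ∣ p.map φ) : d.map (φ.comp MvPolynomial.C) ∣ p' := by
  set D : (MvPolynomial (Coord g) ℂ)[X] := d.map MvPolynomial.C with hD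
  have hDm : D.Monic := hd.map _
  have hDmap : D.map φ = d.map (φ.comp MvPolynomial.C) := Polynomial.map_map _ _ _
  set q := p /ₘ D
  set r := p %ₘ D with hr
  have hpq : r + D * q = p := modByMonic_add_div _ _
  -- The coefficients of the remainder lie in the kernel of `φ`, so `t` kills them. Only `D * q`
  -- contributes, and since `D` has constant coefficients its variation is `D` times that of `q`.
  have hr0 : r.map φ = 0 := by
    rw [hr, map_modByMonic φ hDm, modByMonic_eq_zero_iff_dvd (hDm.map _), hDmap]
    exact hdvd
  let q' : K[X] := ∑ i ∈ Finset.range (q.natDegree + 1), monomial i (tangentDeriv φ t (q.coeff i))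
  have hq' (j : ℕ) : tangentDeriv φ t (q.coeff j) = q'.coeff j := by
    simp only [q', finsetSum_coeff, coeff_monomial, Finset.sum_ite_eq', Finset.mem_range]
    split_ifs with h
    · rfl
    · rw [coeff_eq_zero_of_natDegree_lt (by omega), map_zero]
  have hD' (j : ℕ) : tangentDeriv φ t (D.coeff j) = (0 : K[X]).coeff j := by
    rw [hD, coeff_map, tangentDeriv_C, coeff_zero]
  refine ⟨q', ?_⟩
  ext j
  rw [← hp, ← hpq, coeff_add, map_add, ht (r.coeff j) (by rw [← coeff_map, hr0, coeff_zero]),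
    tangentDeriv_coeff_mul t hD' hq', hDmap, mul_zero, add_zero, zero_add]

end Tangent

end Mumford

namespace Mumford

open Polynomial

/-- The ideal of the equations `h_i = h.coeff i` of the fibre. -/
noncomputable def fibreIdeal (g : ℕ) (h : ℂ[X]) : Ideal (MvPolynomial (Coord g) ℂ) :=
  Ideal.span (Set.range fun i : Fin (2 * g + 1) => hFun g i - MvPolynomial.C (h.coeff i))

/-! ### The fibre over fields and the height bound -/

section Maps

variable {g : ℕ} {R S : Type} [CommRing R] [CommRing S] (f : R →+* S) (a : Coord g → R)

theorem map_uPoly : (uPoly a).map f = uPoly (f ∘ a) := by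
  simp [uPoly, Polynomial.map_sum]

theorem map_vPoly : (vPoly a).map f = vPoly (f ∘ a) := by
  simp [vPoly, Polynomial.map_sum]

theorem map_wPoly : (wPoly a).map f = wPoly (f ∘ a) := by
  simp [wPoly, Polynomial.map_sum]

theorem map_momentMap : (momentMap a).map f = momentMap (f ∘ a) := by
  rw [momentMap_eq, momentMap_eq, Polynomial.map_add, Polynomial.map_mul, Polynomial.map_pow,
    map_uPoly, map_vPoly, map_wPoly]

end Maps

section Field

variable {g : ℕ} {K : Type} [Field K]

theorem monic_uPoly (a : Coord g → K) : (uPoly a).Monic :=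
  monic_X_pow_add (degree_sum_fin_lt _)

theorem natDegree_uPoly (a : Coord g → K) : (uPoly a).natDegree = g := by
  refine natDegree_eq_of_degree_eq_some ?_
  rw [uPoly, degree_add_eq_left_of_degree_lt] <;> rw [degree_X_pow]
  exact degree_sum_fin_lt _

theorem monic_wPoly (a : Coord g → K) : (wPoly a).Monic :=
  monic_X_pow_add (degree_sum_fin_lt _)

theorem natDegree_wPoly (a : Coord g → K) : (wPoly a).natDegree = g + 1 := by
  refine natDegree_eq_of_degree_eq_some ?_
  rw [wPoly, degree_add_eq_left_of_degree_lt] <;> rw [degree_X_pow]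
  exact degree_sum_fin_lt _

theorem degree_vPoly_lt (a : Coord g → K) : (vPoly a).degree < g := degree_sum_fin_lt _

theorem momentMap_monic (a : Coord g → K) :
    (momentMap a).Monic ∧ (momentMap a).natDegree = 2 * g + 1 := by
  have h1 := (monic_uPoly a).mul (monic_wPoly a)
  have h2 : (uPoly a * wPoly a).natDegree = 2 * g + 1 := by
    rw [(monic_uPoly a).natDegree_mul (monic_wPoly a), natDegree_uPoly, natDegree_wPoly]
    ring
  have h3 : (vPoly a ^ 2).degree < (uPoly a * wPoly a).degree := by
    rw [degree_eq_natDegree h1.ne_zero, h2, pow_two]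
    refine (degree_mul_lt_of_lt (n := g) (degree_vPoly_lt a)
      ((degree_vPoly_lt a).trans ?_)).trans ?_
    · exact_mod_cast Nat.lt_succ_self g
    · exact_mod_cast (by omega : g + g < 2 * g + 1)
  rw [momentMap_eq]
  exact ⟨h1.add_of_right h3, by rw [natDegree_add_eq_right_of_degree_lt h3, h2]⟩

variable {φ : MvPolynomial (Coord g) ℂ →+* K} {h : ℂ[X]}

theorem map_hFun (i : ℕ) : φ (hFun g i) = (momentMap (φ ∘ MvPolynomial.X)).coeff i := by
  rw [hFun, ← coeff_map, map_momentMap]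

/-- The primes containing the ideal of the fibre correspond to points of the fibre over fields. -/
theorem fibreIdeal_le_ker_iff (hh : h ∈ monicPolys g) :
    fibreIdeal g h ≤ RingHom.ker φ ↔
      momentMap (φ ∘ MvPolynomial.X) = h.map (φ.comp MvPolynomial.C) := by
  have hgen (i : ℕ) : hFun g i - MvPolynomial.C (h.coeff i) ∈ RingHom.ker φ ↔
      (momentMap (φ ∘ MvPolynomial.X)).coeff i = (h.map (φ.comp MvPolynomial.C)).coeff i := by
    rw [RingHom.mem_ker, map_sub, sub_eq_zero, map_hFun, coeff_map, RingHom.comp_apply]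
  rw [fibreIdeal, Ideal.span_le]
  constructor
  · intro hle
    obtain ⟨hm, hd⟩ := momentMap_monic (φ ∘ MvPolynomial.X : Coord g → K)
    have hm' := hh.1.map (φ.comp MvPolynomial.C)
    have hd' : (h.map (φ.comp MvPolynomial.C)).natDegree = 2 * g + 1 := by
      rw [hh.1.natDegree_map, hh.2]
    ext i
    rcases lt_trichotomy i (2 * g + 1) with hi | hi | hi
    · exact (hgen i).1 (hle ⟨⟨i, hi⟩, rfl⟩)
    · have e1 := hm.coeff_natDegree
      have e2 := hm'.coeff_natDegree
      rw [hd] at e1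
      rw [hd'] at e2
      rw [hi, e1, e2]
    · rw [coeff_eq_zero_of_natDegree_lt (hd ▸ hi), coeff_eq_zero_of_natDegree_lt (hd' ▸ hi)]
  · rintro heq _ ⟨i, rfl⟩
    exact (hgen i).2 (by rw [heq])

/-- Over a field, the common factor of `u`, `v`, `w` on the fibre is defined over `ℂ`. -/
theorem exists_common_factor (hh : h ∈ monicPolys g) (hφ : fibreIdeal g h ≤ RingHom.ker φ) :
    ∃ (d : ℂ[X]) (u v w α β γ : K[X]), d.Monic ∧
      uPoly (φ ∘ MvPolynomial.X) = d.map (φ.comp MvPolynomial.C) * u ∧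
      vPoly (φ ∘ MvPolynomial.X) = d.map (φ.comp MvPolynomial.C) * v ∧
      wPoly (φ ∘ MvPolynomial.X) = d.map (φ.comp MvPolynomial.C) * w ∧
      α * u + β * v + γ * w = 1 := by
  classical
  have heq := (fibreIdeal_le_ker_iff hh).1 hφ
  rw [momentMap_eq] at heq
  set U := uPoly (φ ∘ MvPolynomial.X : Coord g → K) with hU
  set V := vPoly (φ ∘ MvPolynomial.X : Coord g → K)
  set W := wPoly (φ ∘ MvPolynomial.X : Coord g → K)
  obtain ⟨e, he⟩ := (IsPrincipalIdealRing.principal (Ideal.span {U, V, W})).principal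
  change Ideal.span {U, V, W} = Ideal.span {e} at he
  have hUe : e ∣ U := Ideal.mem_span_singleton.1 (he ▸ Ideal.subset_span (by simp))
  have hVe : e ∣ V := Ideal.mem_span_singleton.1 (he ▸ Ideal.subset_span (by simp))
  have hWe : e ∣ W := Ideal.mem_span_singleton.1 (he ▸ Ideal.subset_span (by simp))
  have he0 : e ≠ 0 := by
    rintro rfl
    exact (monic_uPoly _).ne_zero (zero_dvd_iff.1 hUe)
  have hed : e ∣ h.map (φ.comp MvPolynomial.C) := by
    rw [← heq, pow_two]
    exact dvd_add (hVe.mul_right _) (hUe.mul_right _)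
  -- The gcd divides `h`, whose roots all come from `ℂ`; a monic split polynomial with roots in the
  -- image of `ℂ` has its coefficients there as well.
  have hlift : normalize e ∈ Polynomial.lifts (φ.comp MvPolynomial.C) := by
    have hs : (h.map (φ.comp MvPolynomial.C)).Splits := (IsAlgClosed.splits h).map _
    refine (hs.of_dvd (hh.1.map _).ne_zero
      (normalize_dvd_iff.2 hed)).mem_lift_of_roots_mem_range (monic_normalize he0) _ fun x hx => ?_
    have hx' : x ∈ (h.map (φ.comp MvPolynomial.C)).roots :=
      Multiset.mem_of_le (roots.le_of_dvd (hh.1.map _).ne_zero (normalize_dvd_iff.2 hed)) hx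
    rw [(IsAlgClosed.splits h).roots_map] at hx'
    obtain ⟨y, -, rfl⟩ := Multiset.mem_map.1 hx'
    exact ⟨y, rfl⟩
  obtain ⟨d, hd, -, hdm⟩ := lifts_and_natDegree_eq_and_monic hlift (monic_normalize he0)
  have hne : normalize e ≠ 0 := (monic_normalize he0).ne_zero
  obtain ⟨u, hu⟩ := normalize_dvd_iff.2 hUe
  obtain ⟨v, hv⟩ := normalize_dvd_iff.2 hVe
  obtain ⟨w, hw⟩ := normalize_dvd_iff.2 hWe
  have hmem : normalize e ∈ Ideal.span {U, V, W} := by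
    rw [he, Ideal.mem_span_singleton]
    exact (dvd_normalize_iff).2 dvd_rfl
  obtain ⟨α, y, hy, hαy⟩ := Ideal.mem_span_insert.1 hmem
  obtain ⟨β, γ, hβγ⟩ := Ideal.mem_span_pair.1 hy
  refine ⟨d, u, v, w, α, β, γ, hdm, by rw [hd, ← hu], by rw [hd, ← hv], by rw [hd, ← hw], ?_⟩
  refine mul_left_cancel₀ hne ?_
  rw [← hβγ] at hαy
  rw [mul_one]
  conv_rhs => rw [hαy, hu, hv, hw]
  ring

/-- The tangent vectors annihilating a set of polynomials. -/
def tangentAnnihilator (φ : MvPolynomial (Coord g) ℂ →+* K) :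
    Submodule K (Coord g → K) where
  carrier := {t | ∀ F, φ F = 0 → tangentDeriv φ t F = 0}
  zero_mem' := fun F _ => by simp [tangentDeriv_apply]
  add_mem' := fun {s t} hs ht F hF => by
    have h1 := hs F hF
    have h2 := ht F hF
    rw [tangentDeriv_apply] at h1 h2 ⊢
    simp [add_mul, Finset.sum_add_distrib, h1, h2]
  smul_mem' := fun c t ht F hF => by
    have h1 := ht F hF
    rw [tangentDeriv_apply] at h1 ⊢
    simp [mul_assoc, ← Finset.mul_sum, h1]

/-- Under the dot product, the annihilating tangent vectors are the orthogonal of the span of the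
differentials, in a space with `3g+1` coordinates. -/
theorem finrank_tangentAnnihilator_add (φ : MvPolynomial (Coord g) ℂ →+* K) :
    Module.finrank K (Submodule.span K (polyGrad φ '' (RingHom.ker φ : Set _))) +
      Module.finrank K (tangentAnnihilator φ) = 3 * g + 1 := by
  classical
  set W := Submodule.span K (polyGrad φ '' (RingHom.ker φ : Set _)) with hW
  have h1 := Subspace.finrank_add_finrank_dualAnnihilator_eq W
  rw [Module.finrank_pi, Fintype.card_sum, Fintype.card_sum, Fintype.card_fin,
    Fintype.card_fin] at h1
  have h2 : Module.finrank K W.dualAnnihilator = Module.finrank K (tangentAnnihilator φ) := by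
    refine (LinearEquiv.finrank_eq ((dotProductEquiv K (Coord g)).submoduleMap
      (tangentAnnihilator φ) ≪≫ₗ LinearEquiv.ofEq _ _ ?_)).symm
    ext f
    rw [Submodule.mem_dualAnnihilator]
    constructor
    · rintro ⟨t, ht, rfl⟩ x hx
      change dotProduct t x = 0
      induction hx using Submodule.span_induction with
      | mem x hx =>
        obtain ⟨F, hF, rfl⟩ := hx
        exact ht F hF
      | zero => simp
      | add x y _ _ hx hy => rw [dotProduct_add, hx, hy, add_zero]
      | smul a x _ hx => rw [dotProduct_smul, hx, smul_zero]
    · intro hf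
      obtain ⟨t, rfl⟩ := (dotProductEquiv K (Coord g)).surjective f
      exact ⟨t, fun F hF => hf _ (Submodule.subset_span ⟨F, hF, rfl⟩), rfl⟩
  omega

theorem two_ne_zero_of_ringHom (φ : MvPolynomial (Coord g) ℂ →+* K) : (2 : K) ≠ 0 := by
  rw [← map_ofNat (φ.comp MvPolynomial.C) 2]
  exact (_root_.map_ne_zero _).2 two_ne_zero

theorem degree_variation_lt (φ : MvPolynomial (Coord g) ℂ →+* K) (t : Coord g → K) :
    (2 * (vPoly MvPolynomial.X).map φ * vVar t + (uPoly MvPolynomial.X).map φ * wVar t +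
      (wPoly MvPolynomial.X).map φ * uVar t).degree < ((2 * g + 1 : ℕ) : WithBot ℕ) := by
  have had : (uVar t).degree < g := degree_sum_fin_lt _
  have hbd : (vVar t).degree < g := degree_sum_fin_lt _
  have hcd : (wVar t).degree < (g + 1 : ℕ) := degree_sum_fin_lt _
  have hs (m : ℕ) : (m : WithBot ℕ) < (m + 1 : ℕ) := by exact_mod_cast Nat.lt_succ_self m
  refine lt_of_le_of_lt (degree_add_le _ _) (max_lt (lt_of_le_of_lt (degree_add_le _ _)
    (max_lt ?_ ?_)) ?_)
  · rw [map_vPoly, show (2 : K[X]) = C 2 from rfl, mul_assoc,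
      degree_C_mul (two_ne_zero_of_ringHom φ)]
    refine (degree_mul_lt_of_lt (n := g) (degree_vPoly_lt _) (hbd.trans (hs g))).trans ?_
    exact_mod_cast (by omega : g + g < 2 * g + 1)
  · rw [map_uPoly]
    have h1 := degree_mul_lt_of_lt (m := g + 1) (n := g) (p := uPoly (φ ∘ MvPolynomial.X))
      (q := wVar t) (by
        rw [degree_eq_natDegree (monic_uPoly _).ne_zero, natDegree_uPoly]; exact hs g) hcd
    rwa [show g + 1 + g = 2 * g + 1 by ring] at h1
  · rw [map_wPoly, mul_comm]
    have h1 := degree_mul_lt_of_lt (m := g) (n := g + 1) (q := wPoly (φ ∘ MvPolynomial.X))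
      (p := uVar t) had (by
        rw [degree_eq_natDegree (monic_wPoly _).ne_zero, natDegree_wPoly]; exact hs _)
    rwa [show g + (g + 1) = 2 * g + 1 by ring] at h1

/-- As `D` is constant, it divides the variations of its multiples `u`, `v`, `w`. Annihilating the
`h_i` says that the quotients form a syzygy of the reduced triple, in degrees governed by `n = g -
deg D`, so there are at most `n` independent ones. -/
theorem finrank_tangentAnnihilator_le
    (hφ : fibreIdeal g h ≤ RingHom.ker φ) {d : ℂ[X]} (hd : d.Monic) {u v w α β γ : K[X]}
    (hu : uPoly (φ ∘ MvPolynomial.X) = d.map (φ.comp MvPolynomial.C) * u)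
    (hv : vPoly (φ ∘ MvPolynomial.X) = d.map (φ.comp MvPolynomial.C) * v)
    (hw : wPoly (φ ∘ MvPolynomial.X) = d.map (φ.comp MvPolynomial.C) * w)
    (hb : α * u + β * v + γ * w = 1) :
    Module.finrank K (tangentAnnihilator φ) + d.natDegree ≤ g := by
  set D := d.map (φ.comp MvPolynomial.C) with hD
  have hDm : D.Monic := hd.map _
  have hDd : D.natDegree = d.natDegree := hd.natDegree_map _
  have hum : u.Monic := hDm.of_mul_monic_left (hu ▸ monic_uPoly _)
  have hwm : w.Monic := hDm.of_mul_monic_left (hw ▸ monic_wPoly _)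
  have hud : d.natDegree + u.natDegree = g := by
    rw [← hDd, ← hDm.natDegree_mul hum, ← hu, natDegree_uPoly]
  have hwd : d.natDegree + w.natDegree = g + 1 := by
    rw [← hDd, ← hDm.natDegree_mul hwm, ← hw, natDegree_wPoly]
  set n := u.natDegree with hn
  have hlt {p : K[X]} {m : ℕ} (hp : (D * p).degree < (d.natDegree + m : ℕ)) : p.degree < m := by
    by_cases hp0 : p = 0
    · simp [hp0]
    rw [degree_mul, degree_eq_natDegree hDm.ne_zero, degree_eq_natDegree hp0, hDd] at hp
    have h1 : d.natDegree + p.natDegree < d.natDegree + m := by exact_mod_cast hp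
    rw [degree_eq_natDegree hp0]
    exact_mod_cast (by omega : p.natDegree < m)
  have hvd : v.degree < n := hlt (by rw [hud, ← hv]; exact degree_vPoly_lt _)
  have hwd' : w.degree < (n + 2 : ℕ) := by
    rw [degree_eq_natDegree hwm.ne_zero]
    exact_mod_cast (by omega : w.natDegree < n + 2)
  have hker : Module.finrank K (LinearMap.ker (syzygyMap n u v w)) ≤ n :=
    finrank_ker_syzygyMap_le (two_ne_zero_of_ringHom φ) hum rfl hvd hwd' hb
  -- Multiplication by `D` recovers the variations from a syzygy, and their coefficients recover the
  -- tangent vector.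
  let Ψ : LinearMap.ker (syzygyMap n u v w) →ₗ[K] (Coord g → K) :=
    { toFun := fun x => Sum.elim (fun i => (D * x.1.1.1).coeff i)
        (Sum.elim (fun i => (D * x.1.2.1.1).coeff i) (fun i => (D * x.1.2.2.1).coeff i))
      map_add' := fun x y => by
        ext (i | i | i) <;> simp [mul_add]
      map_smul' := fun c x => by
        ext (i | i | i) <;> simp }
  have hle : tangentAnnihilator φ ≤ LinearMap.range Ψ := by
    intro t ht
    obtain ⟨a, ha⟩ : D ∣ uVar t := map_dvd_of_tangentDeriv ht hd (tangentDeriv_coeff_uPoly φ t)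
      (by rw [map_uPoly, hu]; exact dvd_mul_right _ _)
    obtain ⟨b, hb'⟩ : D ∣ vVar t := map_dvd_of_tangentDeriv ht hd (tangentDeriv_coeff_vPoly φ t)
      (by rw [map_vPoly, hv]; exact dvd_mul_right _ _)
    obtain ⟨c, hc⟩ : D ∣ wVar t := map_dvd_of_tangentDeriv ht hd (tangentDeriv_coeff_wPoly φ t)
      (by rw [map_wPoly, hw]; exact dvd_mul_right _ _)
    have had : (uVar t).degree < g := degree_sum_fin_lt _
    have hbd : (vVar t).degree < g := degree_sum_fin_lt _
    have hcd : (wVar t).degree < (g + 1 : ℕ) := degree_sum_fin_lt _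
    have hzero : 2 * (vPoly MvPolynomial.X).map φ * vVar t + (uPoly MvPolynomial.X).map φ * wVar t +
        (wPoly MvPolynomial.X).map φ * uVar t = 0 := by
      ext i
      rw [← tangentDeriv_hFun]
      by_cases hi : i < 2 * g + 1
      · have h1 := ht _ (hφ (Ideal.subset_span ⟨⟨i, hi⟩, rfl⟩))
        rwa [map_sub, tangentDeriv_C, sub_zero] at h1
      · rw [tangentDeriv_hFun, coeff_zero]
        exact coeff_eq_zero_of_degree_lt ((degree_variation_lt φ t).trans_le
          (by exact_mod_cast not_lt.1 hi))
    have hsyz : syzygyMap n u v w (⟨a, mem_degreeLT.2 (hlt (by rw [hud, ← ha]; exact had))⟩,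
        ⟨b, mem_degreeLT.2 (hlt (by rw [hud, ← hb']; exact hbd))⟩,
        ⟨c, mem_degreeLT.2 (hlt (by
          rw [← Nat.add_assoc, hud, ← hc]; exact hcd))⟩) = 0 := by
      rw [syzygyMap_apply]
      rw [map_uPoly, map_vPoly, map_wPoly, hu, hv, hw, ha, hb', hc] at hzero
      -- Each term carries `D` twice: once from the coordinate polynomial and once from its
      -- variation.
      refine mul_left_cancel₀ (mul_ne_zero hDm.ne_zero hDm.ne_zero) ?_
      rw [mul_zero, ← hzero]
      ring
    refine ⟨⟨_, LinearMap.mem_ker.2 hsyz⟩, ?_⟩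
    ext (i | i | i)
    · change (D * a).coeff i = _
      rw [← ha, uVar, coeff_sum_fin, dif_pos i.2]
    · change (D * b).coeff i = _
      rw [← hb', vVar, coeff_sum_fin, dif_pos i.2]
    · change (D * c).coeff i = _
      rw [← hc, wVar, coeff_sum_fin, dif_pos i.2]
  have h1 := Submodule.finrank_mono hle
  have h2 := LinearMap.finrank_range_le Ψ
  omega

/-- Primes containing the ideal of the fibre have height at least `2g+1`, and at primes of height
`2g+1` the polynomials `u`, `v`, `w` have no common factor. -/
theorem le_height_ker (hh : h ∈ monicPolys g) (hφ : fibreIdeal g h ≤ RingHom.ker φ) :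
    ((2 * g + 1 : ℕ) : ℕ∞) ≤ (RingHom.ker φ).height ∧
      ((RingHom.ker φ).height ≤ (2 * g + 1 : ℕ) → ∃ α β γ : K[X],
        α * uPoly (φ ∘ MvPolynomial.X) + β * vPoly (φ ∘ MvPolynomial.X) +
          γ * wPoly (φ ∘ MvPolynomial.X) = 1) := by
  obtain ⟨d, u, v, w, α, β, γ, hd, hu, hv, hw, hb⟩ := exists_common_factor hh hφ
  have h1 := finrank_tangentAnnihilator_le hφ hd hu hv hw hb
  have h2 := finrank_tangentAnnihilator_add φ
  have h3 := finrank_span_polyGrad_le_height (φ := φ)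
  refine ⟨le_trans (Nat.cast_le.2 (by omega)) h3, fun hle => ⟨α, β, γ, ?_⟩⟩
  have h4 := h3.trans hle
  rw [Nat.cast_le] at h4
  -- The rank of the differentials is at least `2g+1+deg d`, so a height of at most `2g+1` leaves no
  -- room for a nonconstant `d`.
  have h5 : d = 1 := hd.natDegree_eq_zero.1 (by omega)
  rw [hu, hv, hw, h5, Polynomial.map_one, one_mul, one_mul, one_mul, hb]

end Field

end Mumford

namespace Mumford

open Polynomial

/-! ### The Jacobian of the moment map -/

section Jacobian

variable {g : ℕ} {K : Type} [Field K] {φ : MvPolynomial (Coord g) ℂ →+* K} {h : ℂ[X]}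

theorem sum_fin_coeff_eq {n : ℕ} {p : K[X]} (hp : p.degree < n) :
    (∑ i : Fin n, C (p.coeff i) * X ^ (i : ℕ)) = p := by
  ext j
  rw [coeff_sum_fin (fun i : Fin n => p.coeff i)]
  split_ifs with h
  · rfl
  · exact (coeff_eq_zero_of_degree_lt (hp.trans_le (by exact_mod_cast not_lt.1 h))).symm

/-- If `u`, `v`, `w` generate the unit ideal, the differential of the moment map is onto. -/
theorem exists_tangentDeriv_hFun_eq
    (hb : ∃ α β γ : K[X], α * uPoly (φ ∘ MvPolynomial.X) + β * vPoly (φ ∘ MvPolynomial.X) +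
      γ * wPoly (φ ∘ MvPolynomial.X) = 1) {q : K[X]} (hq : q.degree < (2 * g + 1 : ℕ)) :
    ∃ t, ∀ i, tangentDeriv φ t (hFun g i) = q.coeff i := by
  obtain ⟨α, β, γ, hb⟩ := hb
  obtain ⟨⟨a, b, c⟩, hx⟩ := exists_syzygyMap_eq (two_ne_zero_of_ringHom φ) (monic_uPoly _)
    (natDegree_uPoly _) (degree_vPoly_lt _) (by
      rw [degree_eq_natDegree (monic_wPoly _).ne_zero, natDegree_wPoly]
      exact_mod_cast Nat.lt_succ_self (g + 1)) hb hq
  refine ⟨Sum.elim (fun i => a.1.coeff i)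
    (Sum.elim (fun i => b.1.coeff i) (fun i => c.1.coeff i)), fun i => ?_⟩
  rw [tangentDeriv_hFun, ← hx, syzygyMap_apply, map_uPoly, map_vPoly, map_wPoly]
  congr 1
  simp only [uVar, vVar, wVar, Sum.elim_inl, Sum.elim_inr]
  rw [sum_fin_coeff_eq (mem_degreeLT.1 a.2), sum_fin_coeff_eq (mem_degreeLT.1 b.2),
    sum_fin_coeff_eq (mem_degreeLT.1 c.2)]
  ring

/-- Surjectivity of the differential supplies, for each `j`, a tangent vector along which `h_j` has
derivative `1` and the other `h_i` derivative `0`. -/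
theorem linearIndependent_polyGrad_hFun
    (hb : ∃ α β γ : K[X], α * uPoly (φ ∘ MvPolynomial.X) + β * vPoly (φ ∘ MvPolynomial.X) +
      γ * wPoly (φ ∘ MvPolynomial.X) = 1) :
    LinearIndependent K fun i : Fin (2 * g + 1) => polyGrad φ (hFun g i) := by
  rw [Fintype.linearIndependent_iff]
  intro l hl j
  obtain ⟨t, ht⟩ := exists_tangentDeriv_hFun_eq hb (q := X ^ (j : ℕ)) (by
    rw [degree_X_pow]; exact_mod_cast j.2)
  have h1 : ∑ i : Fin (2 * g + 1), l i * tangentDeriv φ t (hFun g i) = 0 := by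
    have h2 := congrArg (dotProduct t) hl
    rw [dotProduct_zero, dotProduct_sum] at h2
    rw [← h2]
    refine Finset.sum_congr rfl fun i _ => ?_
    rw [dotProduct_smul]
    rfl
  simp only [ht, coeff_X_pow] at h1
  rw [Finset.sum_eq_single j] at h1
  · simpa using h1
  · intro i _ hij
    rw [if_neg (fun h => hij (Fin.ext h)), mul_zero]
  · simp

/-- A common root of `u`, `v`, `w` gives a linear relation between the differentials of the
`h_i`. -/
theorem sum_pow_smul_polyGrad_hFun {x : K} (hu : (uPoly (φ ∘ MvPolynomial.X)).eval x = 0)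
    (hv : (vPoly (φ ∘ MvPolynomial.X)).eval x = 0)
    (hw : (wPoly (φ ∘ MvPolynomial.X)).eval x = 0) :
    ∑ i : Fin (2 * g + 1), x ^ (i : ℕ) • polyGrad φ (hFun g i) = 0 := by
  classical
  ext c
  have h1 (F) : polyGrad φ F c = tangentDeriv φ (Pi.single c 1) F := by
    simp [tangentDeriv_apply, Pi.single_apply]
  rw [Finset.sum_apply, Pi.zero_apply]
  simp only [Pi.smul_apply, smul_eq_mul, h1, tangentDeriv_hFun]
  set p := 2 * (vPoly MvPolynomial.X).map φ * vVar (Pi.single c 1) +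
    (uPoly MvPolynomial.X).map φ * wVar (Pi.single c 1) +
      (wPoly MvPolynomial.X).map φ * uVar (Pi.single c (1 : K)) with hp
  have hpe : p.eval x = 0 := by
    rw [hp, map_uPoly, map_vPoly, map_wPoly]
    simp [hu, hv, hw]
  have hd : p.degree < ((2 * g + 1 : ℕ) : WithBot ℕ) := degree_variation_lt φ _
  rw [← hpe]
  -- The `c`-component of the sum is the value at `x` of the variation of the moment map along the
  -- `c`-axis; no coefficient is lost, since its degree is below `2g+1`.
  refine Eq.trans ?_ (congrArg (eval x) (sum_fin_coeff_eq hd))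
  rw [eval_finsetSum]
  refine Finset.sum_congr rfl fun i _ => ?_
  rw [eval_mul, eval_C, eval_pow, eval_X, mul_comm]

theorem polyGrad_hFun_sub (i : ℕ) (a : ℂ) :
    polyGrad φ (hFun g i - MvPolynomial.C a) = polyGrad φ (hFun g i) := by
  rw [sub_eq_add_neg, ← map_neg, polyGrad_add, polyGrad_C, add_zero]

end Jacobian

/-! ### The ideal of the fibre is radical -/

section Radical

variable {g : ℕ} {h : ℂ[X]}

theorem le_height_of_fibreIdeal_le (hh : h ∈ monicPolys g) (P : Ideal (MvPolynomial (Coord g) ℂ))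
    [P.IsPrime] (hP : fibreIdeal g h ≤ P) : ((2 * g + 1 : ℕ) : ℕ∞) ≤ P.height := by
  have hker := Ideal.ker_algebraMap_residueField P
  have := (le_height_ker (φ := algebraMap _ P.ResidueField) hh (hker.symm ▸ hP)).1
  rwa [hker] at this

theorem exists_bezout_of_height_le (hh : h ∈ monicPolys g)
    (P : Ideal (MvPolynomial (Coord g) ℂ)) [P.IsPrime] (hP : fibreIdeal g h ≤ P)
    (hht : P.height ≤ (2 * g + 1 : ℕ)) : ∃ α β γ : P.ResidueField[X],
      α * uPoly (algebraMap (MvPolynomial (Coord g) ℂ) P.ResidueField ∘ MvPolynomial.X) +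
      β * vPoly (algebraMap (MvPolynomial (Coord g) ℂ) P.ResidueField ∘ MvPolynomial.X) +
      γ * wPoly (algebraMap (MvPolynomial (Coord g) ℂ) P.ResidueField ∘ MvPolynomial.X) = 1 := by
  have hker := Ideal.ker_algebraMap_residueField P
  exact (le_height_ker (φ := algebraMap _ P.ResidueField) hh (hker.symm ▸ hP)).2 (by rwa [hker])

/-- The ideal of the fibre is generically reduced. -/
theorem exists_mul_mem_fibreIdeal (hh : h ∈ monicPolys g)
    (P : Ideal (MvPolynomial (Coord g) ℂ)) [P.IsPrime] (hP : fibreIdeal g h ≤ P)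
    (hht : P.height ≤ (2 * g + 1 : ℕ)) {F : MvPolynomial (Coord g) ℂ} (hF : F ∈ P) :
    ∃ s ∉ P, s * F ∈ fibreIdeal g h := by
  have hker := Ideal.ker_algebraMap_residueField P
  have hmem (G) : algebraMap (MvPolynomial (Coord g) ℂ) P.ResidueField G = 0 ↔ G ∈ P := by
    rw [← RingHom.mem_ker, hker]
  have hli := linearIndependent_polyGrad_hFun (exists_bezout_of_height_le hh P hP hht)
  obtain ⟨s, hs, hsF⟩ := exists_mul_mem_span_of_linearIndependent
    (φ := algebraMap (MvPolynomial (Coord g) ℂ) P.ResidueField)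
    (fun i : Fin (2 * g + 1) => hFun g i - MvPolynomial.C (h.coeff i))
    (fun i => (hmem _).2 (hP (Ideal.subset_span ⟨i, rfl⟩)))
    (by simpa only [polyGrad_hFun_sub] using hli)
    (by
      rw [hker, Fintype.card_fin]
      exact le_antisymm hht (le_height_of_fibreIdeal_le hh P hP)) ((hmem F).2 hF)
  exact ⟨s, fun h => hs ((hmem s).2 h), hsF⟩

/-- Reducedness need only be tested at associated primes. By unmixedness these have height `2g+1`,
where the ideal is already known to be reduced. -/
theorem isRadical_fibreIdeal (hh : h ∈ monicPolys g) : (fibreIdeal g h).IsRadical := by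
  intro F hF
  by_contra hFI
  have h0 : (Ideal.Quotient.mk (fibreIdeal g h) F) ≠ 0 := by
    rwa [Ne, Ideal.Quotient.eq_zero_iff_mem]
  obtain ⟨P, hP, hle⟩ := exists_le_isAssociatedPrime_of_isNoetherianRing
    (MvPolynomial (Coord g) ℂ) _ h0
  obtain ⟨hPp, y, hy⟩ := isAssociatedPrime_iff.1 hP
  obtain ⟨y, rfl⟩ := Ideal.Quotient.mk_surjective y
  have hmem (r y : MvPolynomial (Coord g) ℂ) :
      r ∈ (⊥ : Submodule (MvPolynomial (Coord g) ℂ) (_ ⧸ fibreIdeal g h)).colon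
        {Ideal.Quotient.mk (fibreIdeal g h) y} ↔ r * y ∈ fibreIdeal g h := by
    rw [Submodule.mem_colon_singleton, Submodule.mem_bot, ← Ideal.Quotient.eq_zero_iff_mem]
    rfl
  have hIP : fibreIdeal g h ≤ P := fun r hr => hle ((hmem r F).2 (Ideal.mul_mem_right _ _ hr))
  let xs := List.ofFn fun i : Fin (2 * g + 1) => hFun g i - MvPolynomial.C (h.coeff i)
  have hxs : Ideal.ofList xs = fibreIdeal g h := by
    rw [Ideal.ofList, fibreIdeal]
    congr 1
    ext r
    exact List.mem_ofFn
  have hlen : xs.length = 2 * g + 1 := List.length_ofFn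
  have hht : P.height = (2 * g + 1 : ℕ) := by
    rw [← hlen]
    refine height_eq_length_of_colon (y := y) (fun Q hQ hle => ?_) fun r => ?_
    · rw [hlen]
      exact le_height_of_fibreIdeal_le hh Q (hxs ▸ hle)
    · rw [hy, hmem, hxs]
  obtain ⟨s, hs, hsF⟩ := exists_mul_mem_fibreIdeal hh P hIP hht.le
    (hPp.radical_le_iff.2 hIP hF)
  exact hs (hle ((hmem s F).2 hsF))

end Radical

/-! ### Density of the coprime locus in the fibre -/

section Density

variable {g : ℕ} {h : ℂ[X]}

/-- Points of the fibre where `u`, `v`, `w` have no common root. -/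
def coprimeLocus (g : ℕ) (h : ℂ[X]) : Set (PhaseSpace g) :=
  {A | A ∈ fibre g h ∧ ∀ x : ℂ, ¬ ((uPoly (coords A)).eval x = 0 ∧ (vPoly (coords A)).eval x = 0 ∧
    (wPoly (coords A)).eval x = 0)}

theorem eval_comp_X (p : Coord g → ℂ) : MvPolynomial.eval p ∘ MvPolynomial.X = p := by
  ext c; simp

theorem eval_comp_C (p : Coord g → ℂ) :
    (MvPolynomial.eval p).comp MvPolynomial.C = RingHom.id ℂ := by
  ext c; simp

theorem fibreIdeal_le_ker_eval_iff (hh : h ∈ monicPolys g) (A : PhaseSpace g) :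
    fibreIdeal g h ≤ RingHom.ker (MvPolynomial.eval (coords A)) ↔ A ∈ fibre g h := by
  rw [fibreIdeal_le_ker_iff hh, eval_comp_X, eval_comp_C, Polynomial.map_id]
  rfl

theorem mem_zeroLocus_iff_le_ker_eval {σ : Type} (I : Ideal (MvPolynomial σ ℂ)) (p : σ → ℂ) :
    p ∈ MvPolynomial.zeroLocus ℂ I ↔ I ≤ RingHom.ker (MvPolynomial.eval p) := by
  rw [MvPolynomial.mem_zeroLocus_iff]
  simp only [MvPolynomial.aeval_eq_eval]
  rfl

theorem fibre_eq_zeroLocus (hh : h ∈ monicPolys g) :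
    fibre g h = coords ⁻¹' MvPolynomial.zeroLocus ℂ (fibreIdeal g h) := by
  ext A
  rw [Set.mem_preimage, mem_zeroLocus_iff_le_ker_eval, fibreIdeal_le_ker_eval_iff hh]

theorem map_eval_uPoly {S : Type} [CommRing S] (ψ : MvPolynomial (Coord g) ℂ →+* S) (x : ℂ) :
    ψ ((uPoly MvPolynomial.X).eval (MvPolynomial.C x)) =
      (uPoly (ψ ∘ MvPolynomial.X)).eval (ψ (MvPolynomial.C x)) := by
  rw [← map_uPoly, eval_map_apply]

theorem map_eval_vPoly {S : Type} [CommRing S] (ψ : MvPolynomial (Coord g) ℂ →+* S) (x : ℂ) :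
    ψ ((vPoly MvPolynomial.X).eval (MvPolynomial.C x)) =
      (vPoly (ψ ∘ MvPolynomial.X)).eval (ψ (MvPolynomial.C x)) := by
  rw [← map_vPoly, eval_map_apply]

theorem map_eval_wPoly {S : Type} [CommRing S] (ψ : MvPolynomial (Coord g) ℂ →+* S) (x : ℂ) :
    ψ ((wPoly MvPolynomial.X).eval (MvPolynomial.C x)) =
      (wPoly (ψ ∘ MvPolynomial.X)).eval (ψ (MvPolynomial.C x)) := by
  rw [← map_wPoly, eval_map_apply]

/-- One of the functions `u(x)`, `v(x)`, `w(x)` serves as `e`: were all three in `P`, then `x` would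
be a common root over the residue field, against Bézout. -/
theorem exists_notMem_forall_eval_eq_zero {P : Ideal (MvPolynomial (Coord g) ℂ)} [P.IsPrime]
    (hb : ∃ α β γ : P.ResidueField[X],
      α * uPoly (algebraMap (MvPolynomial (Coord g) ℂ) P.ResidueField ∘ MvPolynomial.X) +
      β * vPoly (algebraMap (MvPolynomial (Coord g) ℂ) P.ResidueField ∘ MvPolynomial.X) +
      γ * wPoly (algebraMap (MvPolynomial (Coord g) ℂ) P.ResidueField ∘ MvPolynomial.X) = 1)
    (x : ℂ) : ∃ e ∉ P, ∀ A : PhaseSpace g, (uPoly (coords A)).eval x = 0 →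
        (vPoly (coords A)).eval x = 0 → (wPoly (coords A)).eval x = 0 →
        MvPolynomial.eval (coords A) e = 0 := by
  by_contra! hcon
  obtain ⟨α, β, γ, hb⟩ := hb
  set φ := algebraMap (MvPolynomial (Coord g) ℂ) P.ResidueField with hφ
  have hmem (e) (he : e ∈ P) : φ e = 0 := by
    rwa [← RingHom.mem_ker, hφ, Ideal.ker_algebraMap_residueField]
  have hu : φ ((uPoly MvPolynomial.X).eval (MvPolynomial.C x)) = 0 := hmem _ <| by
    by_contra he
    obtain ⟨A, hu, hv, hw, h⟩ := hcon _ he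
    rw [map_eval_uPoly, eval_comp_X, MvPolynomial.eval_C] at h
    exact h hu
  have hv : φ ((vPoly MvPolynomial.X).eval (MvPolynomial.C x)) = 0 := hmem _ <| by
    by_contra he
    obtain ⟨A, hu, hv, hw, h⟩ := hcon _ he
    rw [map_eval_vPoly, eval_comp_X, MvPolynomial.eval_C] at h
    exact h hv
  have hw : φ ((wPoly MvPolynomial.X).eval (MvPolynomial.C x)) = 0 := hmem _ <| by
    by_contra he
    obtain ⟨A, hu, hv, hw, h⟩ := hcon _ he
    rw [map_eval_wPoly, eval_comp_X, MvPolynomial.eval_C] at h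
    exact h hw
  rw [map_eval_uPoly] at hu
  rw [map_eval_vPoly] at hv
  rw [map_eval_wPoly] at hw
  have := congrArg (eval (φ (MvPolynomial.C x))) hb
  simp [eval_add, eval_mul, hu, hv, hw] at this

theorem ncard_fibreIdeal_generators_le : (Set.range fun i : Fin (2 * g + 1) =>
    hFun g i - MvPolynomial.C (h.coeff i)).ncard ≤ 2 * g + 1 := by
  rw [← Set.image_univ]
  refine (Set.ncard_image_le (Set.toFinite _)).trans ?_
  simp

theorem eval_eq_zero_of_common_root {A : PhaseSpace g} (hA : A ∈ fibre g h) {x : ℂ}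
    (hu : (uPoly (coords A)).eval x = 0) (hv : (vPoly (coords A)).eval x = 0) :
    h.eval x = 0 := by
  rw [← show momentMap (coords A) = h from hA, momentMap_eq]
  simp [hu, hv]

/-- By Krull, minimal primes of the ideal have height at most `2g+1`, so `u`, `v`, `w` are coprime
over their residue fields. Hence no component of the fibre lies in the locus where a given root of
`h` is common to the three. -/
theorem vanishingIdeal_coprimeLocus (hh : h ∈ monicPolys g) :
    MvPolynomial.vanishingIdeal ℂ (coords '' coprimeLocus g h) = fibreIdeal g h := by
  classical
  apply le_antisymm
  · intro F hF
    refine isRadical_fibreIdeal hh ?_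
    rw [← Ideal.sInf_minimalPrimes, Ideal.mem_sInf]
    intro P hP
    have hPp : P.IsPrime := hP.1.1
    have hIP : fibreIdeal g h ≤ P := hP.1.2
    have hht : P.height ≤ (2 * g + 1 : ℕ) := by
      refine (Ideal.height_le_card_of_mem_minimalPrimes_span (Set.finite_range _) hP).trans ?_
      exact_mod_cast ncard_fibreIdeal_generators_le
    choose e he hev using
      exists_notMem_forall_eval_eq_zero (exists_bezout_of_height_le hh P hIP hht)
    -- Common roots are roots of `h`, so finitely many factors `e x` suffice to kill the non-coprime
    -- points, while `F` kills the others; the Nullstellensatz puts the product in `P`.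
    have hD : F * ∏ x ∈ h.roots.toFinset, e x ∈ P := by
      rw [← hPp.radical, ← MvPolynomial.vanishingIdeal_zeroLocus_eq_radical (K := ℂ)]
      intro p hp
      rw [MvPolynomial.aeval_eq_eval]
      rw [mem_zeroLocus_iff_le_ker_eval] at hp
      have hpf : coords.symm p ∈ fibre g h := by
        rw [← fibreIdeal_le_ker_eval_iff hh]
        exact hIP.trans hp
      by_cases hc : ∃ x, (uPoly p).eval x = 0 ∧ (vPoly p).eval x = 0 ∧ (wPoly p).eval x = 0
      · obtain ⟨x, hu, hv, hw⟩ := hc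
        have hx : x ∈ h.roots.toFinset := by
          rw [Multiset.mem_toFinset, mem_roots hh.1.ne_zero]
          exact eval_eq_zero_of_common_root hpf hu hv
        show MvPolynomial.eval p _ = 0
        rw [map_mul, map_prod, Finset.prod_eq_zero hx (hev x (coords.symm p) hu hv hw), mul_zero]
      · have := hF p ⟨coords.symm p, ⟨hpf, fun x hx => hc ⟨x, hx⟩⟩, rfl⟩
        rw [MvPolynomial.aeval_eq_eval] at this
        show MvPolynomial.eval p _ = 0
        rw [map_mul, show MvPolynomial.eval p F = 0 from this, zero_mul]
    refine (hPp.mem_or_mem hD).resolve_right fun hp => ?_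
    obtain ⟨x, -, hx⟩ := hPp.prod_mem_iff.1 hp
    exact he x hx
  · rintro F hF _ ⟨A, hA, rfl⟩
    rw [MvPolynomial.aeval_eq_eval]
    exact (fibreIdeal_le_ker_eval_iff hh A).2 hA.1 hF

theorem vanishingIdeal_fibre (hh : h ∈ monicPolys g) :
    MvPolynomial.vanishingIdeal ℂ (coords '' fibre g h) = fibreIdeal g h := by
  apply le_antisymm
  · rw [← vanishingIdeal_coprimeLocus hh]
    rintro F hF _ ⟨A, hA, rfl⟩
    exact hF _ ⟨A, hA.1, rfl⟩
  · rintro F hF _ ⟨A, hA, rfl⟩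
    rw [MvPolynomial.aeval_eq_eval]
    exact (fibreIdeal_le_ker_eval_iff hh A).2 hA hF

end Density

end Mumford

namespace Mumford

/-! ### Local rings of complete intersections and the Jacobian criterion -/

section LocalRing

variable {σ : Type}

theorem polyGrad_X_sub_C {K : Type} [Field K] [DecidableEq σ] (φ : MvPolynomial σ ℂ →+* K) (c : σ)
    (a : ℂ) : polyGrad φ (MvPolynomial.X c - MvPolynomial.C a) = Pi.single c 1 := by
  rw [sub_eq_add_neg, ← map_neg, polyGrad_add, polyGrad_C, add_zero, polyGrad_X]

theorem span_polyGrad_ker_eval [Fintype σ] (p : σ → ℂ) :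
    Submodule.span ℂ (polyGrad (MvPolynomial.eval p) ''
      (RingHom.ker (MvPolynomial.eval p) : Set (MvPolynomial σ ℂ))) = ⊤ := by
  classical
  rw [eq_top_iff, ← (Pi.basisFun ℂ σ).span_eq, Submodule.span_le]
  rintro _ ⟨c, rfl⟩
  refine Submodule.subset_span ⟨MvPolynomial.X c - MvPolynomial.C (p c), ?_, ?_⟩
  · simp
  · rw [polyGrad_X_sub_C, Pi.basisFun_apply]

theorem height_ker_eval [Fintype σ] (p : σ → ℂ) :
    (RingHom.ker (MvPolynomial.eval p)).height = Fintype.card σ := by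
  apply le_antisymm
  · have h := Ideal.height_le_ringKrullDim_of_ne_top
      (RingHom.ker_ne_top (MvPolynomial.eval p))
    rw [MvPolynomial.ringKrullDim_of_isNoetherianRing, ringKrullDim_eq_zero_of_field, zero_add,
      Nat.card_eq_fintype_card] at h
    exact_mod_cast h
  · have h := finrank_span_polyGrad_le_height (φ := MvPolynomial.eval p)
    rwa [span_polyGrad_ker_eval, finrank_top, Module.finrank_fintype_fun_eq_card] at h

variable {S : Set (AffSp σ)} (p : S)

theorem evalAt_mk (F : MvPolynomial σ ℂ) :
    evalAt S p (Ideal.Quotient.mk _ F) = MvPolynomial.eval (coords p.1) F :=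
  rfl

theorem comap_ker_evalAt :
    (RingHom.ker (evalAt S p)).comap (Ideal.Quotient.mk _) =
      RingHom.ker (MvPolynomial.eval (coords p.1)) :=
  rfl

theorem map_ker_eval :
    (RingHom.ker (MvPolynomial.eval (coords p.1))).map (Ideal.Quotient.mk _) =
      RingHom.ker (evalAt S p) := by
  rw [← comap_ker_evalAt, Ideal.map_comap_of_surjective _ Ideal.Quotient.mk_surjective]

theorem vanishingIdeal_le_ker_eval : MvPolynomial.vanishingIdeal ℂ (coords '' S) ≤
    RingHom.ker (MvPolynomial.eval (coords p.1)) :=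
  fun _ hF => hF _ ⟨p.1, p.2, rfl⟩

variable [Fintype σ] {ι : Type} [Fintype ι] {f : ι → MvPolynomial σ ℂ}

/-- The maximal ideal of a point has height `card σ` upstairs. Passing to the quotient lowers it by
at least the minimal height of primes over the ideal, and by at most the number of generators; here
these coincide. -/
theorem ringKrullDim_localRingAt
    (hS : MvPolynomial.vanishingIdeal ℂ (coords '' S) = Ideal.span (Set.range f)) {d : ℕ}
    (hd : Fintype.card σ = Fintype.card ι + d)
    (hht : ∀ Q : Ideal (MvPolynomial σ ℂ), Q.IsPrime → Ideal.span (Set.range f) ≤ Q →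
      (Fintype.card ι : ℕ∞) ≤ Q.height) :
    ringKrullDim (LocalRingAt S p) = d := by
  refine (IsLocalization.AtPrime.ringKrullDim_eq_height (RingHom.ker (evalAt S p))
    (LocalRingAt S p)).trans ?_
  have h1 : (RingHom.ker (evalAt S p)).height ≤ (d : ℕ) := by
    refine height_quotient_le_of_forall_le_height (fun Q hQ hle => hht Q hQ (hS ▸ hle)) d _ ?_
    rw [comap_ker_evalAt, height_ker_eval, hd]
  have h2 : ((Fintype.card ι + d : ℕ) : ℕ∞) ≤
      (RingHom.ker (evalAt S p)).height + (Fintype.card ι : ℕ) := by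
    have hprime := RingHom.ker_isPrime (MvPolynomial.eval (coords p.1))
    rw [← hd, ← height_ker_eval (coords p.1)]
    refine (Ideal.height_le_height_add_spanFinrank_of_le (vanishingIdeal_le_ker_eval p)).trans ?_
    rw [map_ker_eval]
    gcongr
    rw [hS]
    refine (Submodule.spanFinrank_span_le_ncard_of_finite (Set.finite_range f)).trans ?_
    rw [← Set.image_univ]
    refine (Set.ncard_image_le (Set.toFinite _)).trans ?_
    simp
  have h3 : (RingHom.ker (evalAt S p)).height = (d : ℕ) := by
    refine le_antisymm h1 ?_
    lift (RingHom.ker (evalAt S p)).height to ℕ using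
      (h1.trans_lt (ENat.natCast_lt_top d)).ne with a
    norm_cast at h2 ⊢
    lia
  rw [h3]
  rfl

/-- The Jacobian criterion: smoothness forces independent differentials. -/
theorem linearIndependent_polyGrad_of_isSmoothAt
    (hS : MvPolynomial.vanishingIdeal ℂ (coords '' S) = Ideal.span (Set.range f)) {d : ℕ}
    (hd : Fintype.card σ = Fintype.card ι + d) (hdim : ringKrullDim (LocalRingAt S p) = d)
    (hp : IsSmoothAt S p) :
    LinearIndependent ℂ fun i => polyGrad (MvPolynomial.eval (coords p.1)) (f i) := by
  classical
  obtain ⟨Z, hZc, hZm, hZ⟩ := exists_finset_generators_localization (RingHom.ker (evalAt S p))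
  have hreg := hp.spanFinrank_maximalIdeal
  rw [hdim] at hreg
  have hZd : Z.card ≤ d := hZc.trans (by exact_mod_cast hreg.le)
  choose l hl using Ideal.Quotient.mk_surjective (I := MvPolynomial.vanishingIdeal ℂ (coords '' S))
  -- The equations, with lifts of at most `d` local parameters, generate the ideal of the point
  -- locally, so their gradients span the whole cotangent space. There are no more of them than its
  -- dimension, so they are independent.
  let z : ι ⊕ Z → MvPolynomial σ ℂ := Sum.elim f fun y => l y
  have hz (i) : MvPolynomial.eval (coords p.1) (z i) = 0 := by
    rcases i with i | i
    · exact vanishingIdeal_le_ker_eval p (hS ▸ Ideal.subset_span ⟨i, rfl⟩)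
    · rw [← evalAt_mk, ← RingHom.mem_ker]
      simp only [z, Sum.elim_inr, hl]
      exact hZm _ i.2
  have hspan : ⊤ ≤ Submodule.span ℂ (Set.range fun i =>
      polyGrad (MvPolynomial.eval (coords p.1)) (z i)) := by
    rw [← span_polyGrad_ker_eval (coords p.1), Submodule.span_le]
    rintro _ ⟨F, hF, rfl⟩
    obtain ⟨s, hs, hsF⟩ := hZ (Ideal.Quotient.mk _ F) hF
    have hmem : l s * F ∈ Ideal.span (Set.range z) := by
      have h1 : Ideal.Quotient.mk (MvPolynomial.vanishingIdeal ℂ (coords '' S)) (l s * F) ∈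
          (Ideal.span (l '' Z)).map (Ideal.Quotient.mk _) := by
        have hlZ : Ideal.Quotient.mk (MvPolynomial.vanishingIdeal ℂ (coords '' S)) '' (l '' Z) =
            Z := by
          rw [← Set.image_comp, show Ideal.Quotient.mk _ ∘ l = id from funext hl, Set.image_id]
        rw [Ideal.map_span, hlZ, map_mul, hl]
        exact hsF
      rw [← Ideal.mem_comap, Ideal.comap_map_of_surjective _ Ideal.Quotient.mk_surjective,
        ← RingHom.ker_eq_comap_bot, Ideal.mk_ker] at h1
      refine sup_le (Ideal.span_mono ?_) (hS.le.trans (Ideal.span_mono ?_)) h1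
      · rintro _ ⟨y, hy, rfl⟩
        exact ⟨.inr ⟨y, hy⟩, rfl⟩
      · rintro _ ⟨i, rfl⟩
        exact ⟨.inl i, rfl⟩
    have := polyGrad_mem_span_of_mul_mem (φ := MvPolynomial.eval (coords p.1))
      (Z := Set.range z) (by rintro _ ⟨i, rfl⟩; exact hz i) hF (s := l s) (by
        rwa [← evalAt_mk, hl, Ne, ← RingHom.mem_ker]) hmem
    rwa [← Set.range_comp] at this
  have hcard := finrank_le_of_span_eq_top (top_le_iff.1 hspan)
  rw [Module.finrank_fintype_fun_eq_card, Fintype.card_sum, Fintype.card_coe] at hcard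
  have hli := linearIndependent_of_top_le_span_of_card_eq_finrank hspan (by
    rw [Module.finrank_fintype_fun_eq_card, Fintype.card_sum, Fintype.card_coe]
    lia)
  exact hli.comp Sum.inl Sum.inl_injective

/-- The Jacobian criterion: independent differentials give smoothness. -/
theorem isSmoothAt_of_linearIndependent_polyGrad
    (hS : MvPolynomial.vanishingIdeal ℂ (coords '' S) = Ideal.span (Set.range f)) {d : ℕ}
    (hd : Fintype.card σ = Fintype.card ι + d) (hdim : ringKrullDim (LocalRingAt S p) = d)
    (hli : LinearIndependent ℂ fun i => polyGrad (MvPolynomial.eval (coords p.1)) (f i)) :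
    IsSmoothAt S p := by
  classical
  obtain ⟨W, hW⟩ := Submodule.exists_isCompl (Submodule.span ℂ
    (Set.range fun i => polyGrad (MvPolynomial.eval (coords p.1)) (f i)))
  have hWd : Module.finrank ℂ W = d := by
    have h := Submodule.finrank_add_eq_of_isCompl hW
    rw [finrank_span_eq_card hli, Module.finrank_fintype_fun_eq_card] at h
    lia
  let b := Module.finBasisOfFinrankEq ℂ W hWd
  -- Affine functions vanishing at the point whose gradients complete those of the equations to a
  -- basis; they generate the maximal ideal of the local ring of `S`.
  let y : Fin d → MvPolynomial σ ℂ := fun j => ∑ c, MvPolynomial.C ((b j : σ → ℂ) c) *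
    (MvPolynomial.X c - MvPolynomial.C (coords p.1 c))
  have hy (j) : polyGrad (MvPolynomial.eval (coords p.1)) (y j) = b j := by
    simp only [y, polyGrad_sum, polyGrad_mul, polyGrad_C, polyGrad_X_sub_C, smul_zero, add_zero,
      MvPolynomial.eval_C]
    ext c
    simp [Finset.sum_apply, Pi.single_apply]
  have hy0 (j) : MvPolynomial.eval (coords p.1) (y j) = 0 := by simp [y]
  let z : ι ⊕ Fin d → MvPolynomial σ ℂ := Sum.elim f y
  have hli' : LinearIndependent ℂ
      fun i => polyGrad (MvPolynomial.eval (coords p.1)) (z i) := by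
    have h1 : LinearIndependent ℂ fun j => (b j : σ → ℂ) :=
      b.linearIndependent.map' W.subtype (Submodule.ker_subtype W)
    have h2 := hli.sum_type h1 (by
      refine hW.disjoint.mono_right (Submodule.span_le.2 ?_)
      rintro _ ⟨j, rfl⟩
      exact (b j).2)
    have heq : (fun i => polyGrad (MvPolynomial.eval (coords p.1)) (z i)) =
        Sum.elim (fun i => polyGrad (MvPolynomial.eval (coords p.1)) (f i))
          fun j => (b j : σ → ℂ) := by
      ext1 i
      rcases i with i | i
      · rfl
      · exact hy i
    rwa [heq]
  have hz (i) : MvPolynomial.eval (coords p.1) (z i) = 0 := by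
    rcases i with i | i
    · exact vanishingIdeal_le_ker_eval p (hS ▸ Ideal.subset_span ⟨i, rfl⟩)
    · exact hy0 i
  have hmax := maximalIdeal_eq_map_of_forall_mul_mem (RingHom.ker (evalAt S p))
    (Ideal.span (Set.range fun j => Ideal.Quotient.mk _ (y j)))
    (Ideal.span_le.2 (by rintro _ ⟨j, rfl⟩; exact hy0 j)) (by
      intro F hF
      obtain ⟨F, rfl⟩ := Ideal.Quotient.mk_surjective F
      obtain ⟨s, hs, hsF⟩ := exists_mul_mem_span_of_linearIndependent z hz hli'
        (by rw [height_ker_eval, hd, Fintype.card_sum, Fintype.card_fin]) (F := F) hF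
      refine ⟨Ideal.Quotient.mk _ s, hs, ?_⟩
      rw [← map_mul]
      have h1 := Ideal.mem_map_of_mem
        (Ideal.Quotient.mk (MvPolynomial.vanishingIdeal ℂ (coords '' S))) hsF
      rw [Ideal.map_span] at h1
      refine Ideal.span_le.2 ?_ h1
      rintro _ ⟨_, ⟨i | i, rfl⟩, rfl⟩
      · rw [show Ideal.Quotient.mk (MvPolynomial.vanishingIdeal ℂ (coords '' S)) (z (.inl i)) = 0 by
          rw [Ideal.Quotient.eq_zero_iff_mem, hS]
          exact Ideal.subset_span ⟨i, rfl⟩]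
        exact zero_mem _
      · exact Ideal.subset_span ⟨i, rfl⟩)
  refine IsRegularLocalRing.of_spanFinrank_maximalIdeal_le _ ?_
  rw [hdim, hmax, Ideal.map_span, ← Set.range_comp]
  have h1 := Submodule.spanFinrank_span_le_ncard_of_finite (R := LocalRingAt S p)
    (Set.finite_range ((algebraMap _ (LocalRingAt S p)) ∘
      fun j => Ideal.Quotient.mk (MvPolynomial.vanishingIdeal ℂ (coords '' S)) (y j)))
  have h2 : (Set.range ((algebraMap _ (LocalRingAt S p)) ∘ fun j =>
      Ideal.Quotient.mk (MvPolynomial.vanishingIdeal ℂ (coords '' S)) (y j))).ncard ≤ d := by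
    rw [← Set.image_univ]
    refine (Set.ncard_image_le (Set.toFinite _)).trans ?_
    simp
  exact_mod_cast h1.trans h2

end LocalRing

section Fibre

open Polynomial

variable {g : ℕ} {h : ℂ[X]}

theorem card_coord (g : ℕ) :
    Fintype.card (Coord g) = Fintype.card (Fin (2 * g + 1)) + g := by
  simp only [Coord, Fintype.card_sum, Fintype.card_fin]
  lia

/-- The differentials of the `h_i` are independent exactly when `u`, `v`, `w` have no common
root. -/
theorem linearIndependent_polyGrad_hFun_iff (p : Coord g → ℂ) :
    (LinearIndependent ℂ fun i : Fin (2 * g + 1) =>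
      polyGrad (MvPolynomial.eval p) (hFun g i)) ↔
    ∀ x : ℂ, ¬ ((uPoly p).eval x = 0 ∧ (vPoly p).eval x = 0 ∧ (wPoly p).eval x = 0) := by
  constructor
  · rintro hli x ⟨hu, hv, hw⟩
    have h := sum_pow_smul_polyGrad_hFun (φ := MvPolynomial.eval p) (x := x)
      (by rwa [eval_comp_X]) (by rwa [eval_comp_X]) (by rwa [eval_comp_X])
    -- The coefficient of index `0` is `x^0 = 1`, even for `x = 0`, so the relation is nontrivial.
    simpa using Fintype.linearIndependent_iff.1 hli (fun i => x ^ (i : ℕ)) h 0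
  · intro hx
    refine linearIndependent_polyGrad_hFun ?_
    rw [eval_comp_X]
    have hI : Ideal.span {uPoly p, vPoly p, wPoly p} = ⊤ := by
      by_contra hne
      obtain ⟨q, hq⟩ := (IsPrincipalIdealRing.principal
        (Ideal.span {uPoly p, vPoly p, wPoly p})).principal
      have hmem (r) (hr : r ∈ ({uPoly p, vPoly p, wPoly p} : Set ℂ[X])) : q ∣ r := by
        rw [← Ideal.mem_span_singleton, Ideal.span, ← hq]
        exact Ideal.subset_span hr
      have hqd : q.degree ≠ 0 := by
        intro h0
        refine hne (hq.trans ((Ideal.span_singleton_eq_top).2 ?_))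
        exact isUnit_iff_degree_eq_zero.2 h0
      obtain ⟨x, hx'⟩ := IsAlgClosed.exists_root q hqd
      exact hx x ⟨hx'.dvd (hmem _ (by simp)), hx'.dvd (hmem _ (by simp)),
        hx'.dvd (hmem _ (by simp))⟩
    have h1 : (1 : ℂ[X]) ∈ Ideal.span {uPoly p, vPoly p, wPoly p} := hI ▸ Submodule.mem_top
    obtain ⟨a, b, c, h⟩ := Submodule.mem_span_triple.1 h1
    exact ⟨a, b, c, h⟩

theorem ringKrullDim_localRingAt_of_vanishingIdeal_eq (hh : h ∈ monicPolys g)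
    {S : Set (PhaseSpace g)}
    (hS : MvPolynomial.vanishingIdeal ℂ (coords '' S) = fibreIdeal g h) (p : S) :
    ringKrullDim (LocalRingAt S p) = g :=
  ringKrullDim_localRingAt p hS (card_coord g) fun Q _ hQ => by
    rw [Fintype.card_fin]
    exact le_height_of_fibreIdeal_le hh Q hQ

/-- Stated for any `S` with the vanishing ideal of the fibre, so that it serves both for the fibre
and for its dense stratum. -/
theorem isSmoothAt_iff (hh : h ∈ monicPolys g) {S : Set (PhaseSpace g)}
    (hS : MvPolynomial.vanishingIdeal ℂ (coords '' S) = fibreIdeal g h) (p : S) :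
    IsSmoothAt S p ↔ ∀ x : ℂ, ¬ ((uPoly (coords p.1)).eval x = 0 ∧
      (vPoly (coords p.1)).eval x = 0 ∧ (wPoly (coords p.1)).eval x = 0) := by
  rw [← linearIndependent_polyGrad_hFun_iff]
  have hdim := ringKrullDim_localRingAt_of_vanishingIdeal_eq hh hS p
  have heq : (fun i : Fin (2 * g + 1) => polyGrad (MvPolynomial.eval (coords p.1)) (hFun g i)) =
      fun i : Fin (2 * g + 1) => polyGrad (MvPolynomial.eval (coords p.1))
        (hFun g i - MvPolynomial.C (h.coeff i)) :=
    funext fun i => (polyGrad_hFun_sub _ _).symm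
  rw [heq]
  exact ⟨linearIndependent_polyGrad_of_isSmoothAt p hS (card_coord g) hdim,
    isSmoothAt_of_linearIndependent_polyGrad p hS (card_coord g) hdim⟩

end Fibre

end Mumford

namespace Mumford

open Polynomial

/-! ### Shifted convolution sums -/

section Convolution

variable {R : Type} [CommRing R]

theorem sum_fin_mul_ite_eq {n i : ℕ} (hn : n ≤ i + 1) (a b : ℕ → R) (ha : ∀ k, n ≤ k → a k = 0) :
    ∑ k : Fin n, a k * (if (k : ℕ) ≤ i then b (i - k) else 0) =
      ∑ k ∈ Finset.range (i + 1), a k * b (i - k) := by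
  rw [← Finset.sum_range fun k => a k * (if k ≤ i then b (i - k) else 0)]
  rw [Finset.sum_subset (Finset.range_subset_range.2 hn) fun k _ hk => by
    rw [ha k (not_lt.1 fun h => hk (Finset.mem_range.2 h)), zero_mul]]
  refine Finset.sum_congr rfl fun k hk => ?_
  rw [if_pos (Nat.lt_succ_iff.1 (Finset.mem_range.1 hk))]

theorem sum_range_mul_comm (a b : ℕ → R) (n : ℕ) :
    ∑ k ∈ Finset.range (n + 1), a k * b (n - k) = ∑ k ∈ Finset.range (n + 1), b k * a (n - k) := by
  rw [← Finset.sum_range_reflect]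
  refine Finset.sum_congr rfl fun k hk => ?_
  have := Finset.mem_range.1 hk
  rw [show n + 1 - 1 - k = n - k by lia, show n - (n - k) = k by lia, mul_comm]

theorem sum_range_shift (a b : ℕ → R) (i j : ℕ) :
    ∑ k ∈ Finset.range (i + 1), a (j + 1 + k) * b (i - k) =
      ∑ k ∈ Finset.range (i + j + 1 + 1), a k * b (i + j + 1 - k) -
        ∑ k ∈ Finset.range (j + 1), a k * b (i + j + 1 - k) := by
  rw [show i + j + 1 + 1 = j + 1 + (i + 1) by lia, Finset.sum_range_add _ (j + 1) (i + 1),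
    add_sub_cancel_left]
  refine Finset.sum_congr rfl fun k hk => ?_
  have := Finset.mem_range.1 hk
  rw [show i + j + 1 - (j + 1 + k) = i - k by lia]

theorem sum_range_shift_of_eq_zero {a b : ℕ → R} {i : ℕ} (j : ℕ) (hb : ∀ k, i < k → b k = 0) :
    ∑ k ∈ Finset.range (i + 1), a (j + 1 + k) * b (i - k) =
      ∑ k ∈ Finset.range (i + j + 1 + 1), a k * b (i + j + 1 - k) := by
  rw [sum_range_shift, sub_eq_self]
  refine Finset.sum_eq_zero fun k hk => ?_
  have := Finset.mem_range.1 hk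
  rw [hb _ (by lia), mul_zero]

/-- Variant for `w`, whose degree is one higher than that of `u`: one boundary term of the Cauchy
product survives. -/
theorem sum_range_shift_of_eq_zero_succ {a b : ℕ → R} {i : ℕ} (j : ℕ)
    (hb : ∀ k, i + 1 < k → b k = 0) :
    ∑ k ∈ Finset.range (i + 1), a (j + 1 + k) * b (i - k) =
      ∑ k ∈ Finset.range (i + j + 1 + 1), a k * b (i + j + 1 - k) - a j * b (i + 1) := by
  have h0 : ∑ k ∈ Finset.range j, a k * b (i + j + 1 - k) = 0 := by
    refine Finset.sum_eq_zero fun k hk => ?_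
    have := Finset.mem_range.1 hk
    rw [hb _ (by lia), mul_zero]
  rw [sum_range_shift, Finset.sum_range_succ _ j, h0, zero_add, show i + j + 1 - j = i + 1 by lia]

end Convolution

/-! ### The Poisson tensor, Casimirs and the maximal stratum -/

section Hamiltonian

variable {g : ℕ} (A : PhaseSpace g)

/-- The contraction of covectors with the Poisson tensor at a point. -/
noncomputable def poissonMap : (Coord g → ℂ) →ₗ[ℂ] (Coord g → ℂ) :=
  Matrix.mulVecLin (Matrix.of fun a b => MvPolynomial.eval (coords A) (coordBracket g a b))

theorem poissonMap_apply (ξ : Coord g → ℂ) (c : Coord g) :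
    poissonMap A ξ c = ∑ b, MvPolynomial.eval (coords A) (coordBracket g c b) * ξ b :=
  rfl

theorem hamiltonianField_eq (i : ℕ) :
    hamiltonianField g i A = poissonMap A (polyGrad (MvPolynomial.eval (coords A)) (hFun g i)) := by
  classical
  ext c
  rw [hamiltonianField, poissonBracket, map_sum, Finset.sum_eq_single c]
  · simp [poissonMap_apply, polyGrad]
  · intro b _ hb
    simp [MvPolynomial.pderiv_X_of_ne (Ne.symm hb)]
  · simp

theorem eval_uFun (k : ℕ) : MvPolynomial.eval (coords A) (uFun g k) =
    (uPoly (coords A)).coeff k := by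
  rw [uFun, ← Polynomial.coeff_map, map_uPoly, eval_comp_X]

theorem eval_vFun (k : ℕ) : MvPolynomial.eval (coords A) (vFun g k) =
    (vPoly (coords A)).coeff k := by
  rw [vFun, ← Polynomial.coeff_map, map_vPoly, eval_comp_X]

theorem eval_wFun (k : ℕ) : MvPolynomial.eval (coords A) (wFun g k) =
    (wPoly (coords A)).coeff k := by
  rw [wFun, ← Polynomial.coeff_map, map_wPoly, eval_comp_X]

theorem polyGrad_apply_eq_tangentDeriv (F : MvPolynomial (Coord g) ℂ) (c : Coord g) :
    polyGrad (MvPolynomial.eval (coords A)) F c =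
      tangentDeriv (MvPolynomial.eval (coords A)) (Pi.single c 1) F := by
  simp [tangentDeriv_apply, Pi.single_apply]

theorem polyGrad_hFun_inl (i : ℕ) (j : Fin g) :
    polyGrad (MvPolynomial.eval (coords A)) (hFun g i) (.inl j) =
      if (j : ℕ) ≤ i then (wPoly (coords A)).coeff (i - j) else 0 := by
  rw [polyGrad_apply_eq_tangentDeriv, tangentDeriv_hFun, map_uPoly, map_vPoly, map_wPoly,
    eval_comp_X, ← coeff_mul_X_pow']
  simp [uVar, vVar, wVar, Pi.single_apply]

theorem polyGrad_hFun_inr_inl (i : ℕ) (j : Fin g) :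
    polyGrad (MvPolynomial.eval (coords A)) (hFun g i) (.inr (.inl j)) =
      2 * if (j : ℕ) ≤ i then (vPoly (coords A)).coeff (i - j) else 0 := by
  rw [polyGrad_apply_eq_tangentDeriv, tangentDeriv_hFun, map_uPoly, map_vPoly, map_wPoly,
    eval_comp_X, ← coeff_mul_X_pow', ← coeff_C_mul]
  simp [uVar, vVar, wVar, Pi.single_apply, mul_assoc]

theorem polyGrad_hFun_inr_inr (i : ℕ) (j : Fin (g + 1)) :
    polyGrad (MvPolynomial.eval (coords A)) (hFun g i) (.inr (.inr j)) =
      if (j : ℕ) ≤ i then (uPoly (coords A)).coeff (i - j) else 0 := by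
  rw [polyGrad_apply_eq_tangentDeriv, tangentDeriv_hFun, map_uPoly, map_vPoly, map_wPoly,
    eval_comp_X, ← coeff_mul_X_pow']
  simp [uVar, vVar, wVar, Pi.single_apply]

theorem coeff_uPoly_self {K : Type} [Field K] (a : Coord g → K) :
    (uPoly a).coeff g = 1 := by
  have := monic_uPoly a
  rwa [Monic, leadingCoeff, natDegree_uPoly] at this

theorem coeff_uPoly_of_lt {K : Type} [Field K] (a : Coord g → K) {k : ℕ}
    (hk : g < k) : (uPoly a).coeff k = 0 :=
  coeff_eq_zero_of_natDegree_lt (by rwa [natDegree_uPoly])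

theorem coeff_vPoly_of_le {K : Type} [Field K] (a : Coord g → K) {k : ℕ}
    (hk : g ≤ k) : (vPoly a).coeff k = 0 :=
  coeff_eq_zero_of_degree_lt ((degree_vPoly_lt a).trans_le (by exact_mod_cast hk))

theorem coeff_wPoly_self {K : Type} [Field K] (a : Coord g → K) :
    (wPoly a).coeff (g + 1) = 1 := by
  have := monic_wPoly a
  rwa [Monic, leadingCoeff, natDegree_wPoly] at this

theorem coeff_wPoly_of_lt {K : Type} [Field K] (a : Coord g → K) {k : ℕ}
    (hk : g + 1 < k) : (wPoly a).coeff k = 0 :=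
  coeff_eq_zero_of_natDegree_lt (by rwa [natDegree_wPoly])

/-- The functions `h_i` with `g ≤ i` are Casimirs. -/
theorem hamiltonianField_eq_zero {i : ℕ} (hi : g ≤ i) : hamiltonianField g i A = 0 := by
  have hU0 (k) (hk : i < k) : (uPoly (coords A)).coeff k = 0 := coeff_uPoly_of_lt _ (by lia)
  have hV0 (k) (hk : i < k) : (vPoly (coords A)).coeff k = 0 := coeff_vPoly_of_le _ (by lia)
  have hW0 (k) (hk : i + 1 < k) : (wPoly (coords A)).coeff k = 0 := coeff_wPoly_of_lt _ (by lia)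
  -- Both sides are leading coefficients `1` when `i = g`, and both are `0` beyond. This equality
  -- cancels the `δ`-terms of the bracket against the boundary terms of the convolutions; the rest
  -- cancels by commutativity of products such as `uv = vu`.
  have hWU : (wPoly (coords A)).coeff (i + 1) = (uPoly (coords A)).coeff i := by
    rcases hi.eq_or_lt with rfl | hlt
    · rw [coeff_wPoly_self, coeff_uPoly_self]
    · rw [coeff_wPoly_of_lt _ (by lia), coeff_uPoly_of_lt _ hlt]
  have hU1 (k) (hk : g < k) : (uPoly (coords A)).coeff k = 0 := coeff_uPoly_of_lt _ hk
  have hV1 (k) (hk : g ≤ k) : (vPoly (coords A)).coeff k = 0 := coeff_vPoly_of_le _ hk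
  have hW1 (k) (hk : g + 1 < k) : (wPoly (coords A)).coeff k = 0 := coeff_wPoly_of_lt _ hk
  have hWg : (wPoly (coords A)).coeff (g + 1) = (uPoly (coords A)).coeff g := by
    rw [coeff_wPoly_self, coeff_uPoly_self]
  rw [hamiltonianField_eq]
  ext c
  rw [poissonMap_apply, Fintype.sum_sum_type, Fintype.sum_sum_type, Pi.zero_apply]
  simp only [polyGrad_hFun_inl, polyGrad_hFun_inr_inl, polyGrad_hFun_inr_inr]
  generalize hU : (uPoly (coords A)).coeff = U at *
  generalize hV : (vPoly (coords A)).coeff = V at *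
  generalize hW : (wPoly (coords A)).coeff = W at *
  have hUV := sum_range_mul_comm U V
  have hUW := sum_range_mul_comm U W
  have hVW := sum_range_mul_comm V W
  rcases c with j | j | j
  · simp only [coordBracket, map_zero, zero_mul, Finset.sum_const_zero, zero_add, map_mul, map_neg,
      map_ofNat, eval_uFun, eval_vFun, hU, hV]
    have e1 : ∑ k : Fin g, U (j + k + 1) * (2 * if (k : ℕ) ≤ i then V (i - k) else 0) =
        2 * ∑ k ∈ Finset.range (i + 1), U (j + 1 + k) * V (i - k) := by
      rw [← sum_fin_mul_ite_eq (n := g) (by lia) (fun k => U (j + 1 + k)) V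
        (fun k hk => hU1 _ (by lia)), Finset.mul_sum]
      refine Finset.sum_congr rfl fun k _ => ?_
      rw [add_right_comm]; ring
    have e2 : ∑ k : Fin (g + 1), -2 * V (j + k + 1) * (if (k : ℕ) ≤ i then U (i - k) else 0) =
        -2 * ∑ k ∈ Finset.range (i + 1), V (j + 1 + k) * U (i - k) := by
      rw [← sum_fin_mul_ite_eq (n := g + 1) (by lia) (fun k => V (j + 1 + k)) U
        (fun k hk => hV1 _ (by lia)), Finset.mul_sum]
      refine Finset.sum_congr rfl fun k _ => ?_
      rw [add_right_comm]; ring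
    rw [e1, e2, sum_range_shift_of_eq_zero _ hV0, sum_range_shift_of_eq_zero _ hU0, hUV]
    ring
  · simp only [coordBracket, map_zero, zero_mul, Finset.sum_const_zero, zero_add, map_neg, map_sub,
      eval_uFun, eval_wFun, apply_ite (MvPolynomial.eval (coords A)), hU, hW]
    have e1 : ∑ k : Fin g, -U (k + j + 1) * (if (k : ℕ) ≤ i then W (i - k) else 0) =
        -∑ k ∈ Finset.range (i + 1), U (j + 1 + k) * W (i - k) := by
      rw [← sum_fin_mul_ite_eq (n := g) (by lia) (fun k => U (j + 1 + k)) W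
        (fun k hk => hU1 _ (by lia)), ← Finset.sum_neg_distrib]
      refine Finset.sum_congr rfl fun k _ => ?_
      rw [add_comm (k : ℕ), add_right_comm]; ring
    have e2 : ∑ k : Fin (g + 1), (W (j + k + 1) - if (k : ℕ) = 0 then U j else 0) *
          (if (k : ℕ) ≤ i then U (i - k) else 0) =
        ∑ k ∈ Finset.range (i + 1), W (j + 1 + k) * U (i - k) - U j * U i := by
      rw [← sum_fin_mul_ite_eq (n := g + 1) (by lia) (fun k => W (j + 1 + k)) U
        (fun k hk => hW1 _ (by lia)), Fin.sum_univ_succ, Fin.sum_univ_succ (n := g)]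
      simp [add_right_comm]
      ring
    rw [e1, e2, sum_range_shift_of_eq_zero_succ _ hW0, sum_range_shift_of_eq_zero _ hU0, hUW, hWU]
    ring
  · simp only [coordBracket, map_zero, map_mul, map_neg, map_sub, map_ofNat, eval_uFun,
      eval_vFun, eval_wFun, apply_ite (MvPolynomial.eval (coords A)),
      hU, hV, hW]
    have e1 : ∑ k : Fin g, 2 * V (k + j + 1) * (if (k : ℕ) ≤ i then W (i - k) else 0) =
        2 * ∑ k ∈ Finset.range (i + 1), V (j + 1 + k) * W (i - k) := by
      rw [← sum_fin_mul_ite_eq (n := g) (by lia) (fun k => V (j + 1 + k)) W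
        (fun k hk => hV1 _ (by lia)), Finset.mul_sum]
      refine Finset.sum_congr rfl fun k _ => ?_
      rw [add_comm (k : ℕ), add_right_comm]; ring
    have e2 : ∑ k : Fin g, -(W (k + j + 1) - if (j : ℕ) = 0 then U k else 0) *
          (2 * if (k : ℕ) ≤ i then V (i - k) else 0) =
        -2 * (∑ k ∈ Finset.range (i + 1), W (j + 1 + k) * V (i - k) -
          if (j : ℕ) = 0 then ∑ k ∈ Finset.range (i + 1), U k * V (i - k) else 0) := by
      have := sum_fin_mul_ite_eq (n := g) (i := i) (by lia)
        (fun k => W (j + 1 + k) - if (j : ℕ) = 0 then U k else 0) V (fun k hk => by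
          -- For `j = 0` the summand at `k = g` is `w_{g+1} - u_g = 0`, so summing over `k < g`
          -- loses nothing.
          split_ifs with h0
          · rw [h0, zero_add]
            rcases hk.eq_or_lt with rfl | hk
            · rw [add_comm 1, hWg, sub_self]
            · rw [hW1 _ (by lia), hU1 _ hk, sub_self]
          · rw [hW1 _ (by lia), sub_self])
      have h2 : ∑ k ∈ Finset.range (i + 1), (W (j + 1 + k) - if (j : ℕ) = 0 then U k else 0) *
          V (i - k) = ∑ k ∈ Finset.range (i + 1), W (j + 1 + k) * V (i - k) -
          if (j : ℕ) = 0 then ∑ k ∈ Finset.range (i + 1), U k * V (i - k) else 0 := by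
        split_ifs <;> simp [sub_mul]
      rw [← h2, ← this, Finset.mul_sum]
      refine Finset.sum_congr rfl fun k _ => ?_
      rw [add_comm (k : ℕ), add_right_comm]; ring
    have e3 : ∑ k : Fin (g + 1), 2 * ((if (k : ℕ) = 0 then V j else 0) -
          if (j : ℕ) = 0 then V k else 0) * (if (k : ℕ) ≤ i then U (i - k) else 0) =
        2 * (V j * U i -
          if (j : ℕ) = 0 then ∑ k ∈ Finset.range (i + 1), V k * U (i - k) else 0) := by
      have h1 : (if (j : ℕ) = 0 then ∑ k ∈ Finset.range (i + 1), V k * U (i - k) else 0) =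
          ∑ k : Fin (g + 1), (if (j : ℕ) = 0 then V k else 0) *
            (if (k : ℕ) ≤ i then U (i - k) else 0) := by
        rw [← sum_fin_mul_ite_eq (n := g + 1) (by lia) V U (fun k hk => hV1 _ (by lia))]
        split_ifs <;> simp
      have h2 : V j * U i = ∑ k : Fin (g + 1), (if (k : ℕ) = 0 then V j else 0) *
            (if (k : ℕ) ≤ i then U (i - k) else 0) := by
        rw [Fin.sum_univ_succ]
        simp
      rw [h1, h2, ← Finset.sum_sub_distrib, Finset.mul_sum]
      refine Finset.sum_congr rfl fun k _ => ?_
      ring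
    rw [e1, e2, e3, sum_range_shift_of_eq_zero_succ _ hW0, sum_range_shift_of_eq_zero _ hV0, hVW,
      hWU, hUV]
    ring

/-- The Hankel matrix `u_{j+k+1}` is triangular about its antidiagonal, where all entries are `u_g =
1`. -/
theorem eq_zero_of_sum_shift_mul_eq_zero {U : ℕ → ℂ} (hg : U g = 1) (hU : ∀ k, g < k → U k = 0)
    {a : Fin g → ℂ} (ha : ∀ j : Fin g, ∑ k : Fin g, U (j + k + 1) * a k = 0) : a = 0 := by
  have key (n : ℕ) : ∀ k : Fin g, (k : ℕ) = n → a k = 0 := by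
    induction n using Nat.strong_induction_on with
    | _ n ih =>
      intro k hk
      have h := ha k.rev
      rw [Finset.sum_eq_single k] at h
      · rw [Fin.val_rev, show g - (k + 1) + k + 1 = g by lia, hg, one_mul] at h
        exact h
      · intro l _ hl
        have hl' : (l : ℕ) ≠ k := fun h => hl (Fin.ext h)
        rcases lt_or_gt_of_ne hl' with hlt | hlt
        · rw [ih l (by lia) l rfl, mul_zero]
        · rw [hU, zero_mul]
          rw [Fin.val_rev]
          lia
      · simp
  ext k
  exact key k k rfl

/-- A Casimir covector is determined by its `w`-components. -/
theorem eq_zero_of_poissonMap_eq_zero {ξ : Coord g → ℂ} (h : poissonMap A ξ = 0)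
    (hw : ∀ j, ξ (.inr (.inr j)) = 0) : ξ = 0 := by
  have hv : (fun k => ξ (.inr (.inl k))) = 0 := by
    refine eq_zero_of_sum_shift_mul_eq_zero (coeff_uPoly_self (coords A))
      (fun k hk => coeff_uPoly_of_lt (coords A) hk) fun j => ?_
    have := congrFun h (.inl j)
    rw [poissonMap_apply, Fintype.sum_sum_type, Fintype.sum_sum_type] at this
    simpa [coordBracket, hw, eval_uFun] using this
  have hu : (fun k => ξ (.inl k)) = 0 := by
    refine eq_zero_of_sum_shift_mul_eq_zero (coeff_uPoly_self (coords A))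
      (fun k hk => coeff_uPoly_of_lt (coords A) hk) fun j => ?_
    have := congrFun h (.inr (.inl j))
    rw [poissonMap_apply, Fintype.sum_sum_type, Fintype.sum_sum_type] at this
    simpa [coordBracket, hw, eval_uFun, add_comm] using this
  ext c
  rcases c with j | j | j
  · exact congrFun hu j
  · exact congrFun hv j
  · exact hw j

theorem finrank_ker_poissonMap_le : Module.finrank ℂ (poissonMap A).ker ≤ g + 1 := by
  let ρ : (poissonMap A).ker →ₗ[ℂ] (Fin (g + 1) → ℂ) :=
    (LinearMap.funLeft ℂ ℂ fun j : Fin (g + 1) => (.inr (.inr j) : Coord g)).comp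
      (poissonMap A).ker.subtype
  have hρ : Function.Injective ρ := by
    rw [← LinearMap.ker_eq_bot, LinearMap.ker_eq_bot']
    intro ξ hξ
    exact Subtype.ext (eq_zero_of_poissonMap_eq_zero A ξ.2 fun j => congrFun hξ j)
  simpa using LinearMap.finrank_le_finrank_of_injective hρ

/-- The `g+1` independent Casimir differentials fill the kernel of the Poisson tensor, whose
dimension is at most `g+1`. The span of the other `g` differentials meets it trivially, so their
images stay independent. -/
theorem linearIndependent_hamiltonianField
    (hli : LinearIndependent ℂ fun i : Fin (2 * g + 1) =>
      polyGrad (MvPolynomial.eval (coords A)) (hFun g i)) :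
    LinearIndependent ℂ fun k : Fin g => hamiltonianField g k A := by
  let v := fun i : Fin (2 * g + 1) => polyGrad (MvPolynomial.eval (coords A)) (hFun g i)
  let l : Fin g → Fin (2 * g + 1) := fun k => ⟨k, by lia⟩
  let r : Fin (g + 1) → Fin (2 * g + 1) := fun k => ⟨g + k, by lia⟩
  have hl : Function.Injective l := fun a b hab => by
    simp only [l, Fin.mk.injEq] at hab
    exact Fin.ext hab
  have hr : Function.Injective r := fun a b hab => by
    simp only [r, Fin.mk.injEq] at hab
    exact Fin.ext (by lia)
  have hlr : Disjoint (Set.range l) (Set.range r) := by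
    rw [Set.disjoint_left]
    rintro _ ⟨a, rfl⟩ ⟨b, hab⟩
    simp only [l, r, Fin.mk.injEq] at hab
    lia
  have hker : Submodule.span ℂ (v '' Set.range r) = (poissonMap A).ker := by
    refine Submodule.eq_of_le_of_finrank_le (Submodule.span_le.2 ?_) ?_
    · rintro _ ⟨_, ⟨k, rfl⟩, rfl⟩
      exact (hamiltonianField_eq A _).symm.trans (hamiltonianField_eq_zero A (by simp [r]))
    · rw [← Set.range_comp, finrank_span_eq_card (hli.comp r hr), Fintype.card_fin]
      exact finrank_ker_poissonMap_le A
  have hd := hli.disjoint_span_image hlr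
  rw [hker, ← Set.range_comp] at hd
  have := (hli.comp l hl).map hd
  rwa [show (fun k : Fin g => hamiltonianField g k A) = poissonMap A ∘ v ∘ l from
    funext fun k => hamiltonianField_eq A k]

theorem mem_stratum_iff : A ∈ stratum g g ↔ ∀ x : ℂ, ¬ ((uPoly (coords A)).eval x = 0 ∧
    (vPoly (coords A)).eval x = 0 ∧ (wPoly (coords A)).eval x = 0) := by
  have h1 : A ∈ stratum g g ↔ LinearIndependent ℂ fun k : Fin g => hamiltonianField g k A := by
    rw [linearIndependent_iff_card_eq_finrank_span, Fintype.card_fin, eq_comm]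
    rfl
  rw [h1]
  refine ⟨?_, fun h => linearIndependent_hamiltonianField A
    ((linearIndependent_polyGrad_hFun_iff (coords A)).2 h)⟩
  rintro hli x ⟨hu, hv, hw⟩
  -- For `g = 0` the polynomial `u` is `1` and has no root; otherwise index `0` exists and carries
  -- the coefficient `x^0 = 1`.
  rcases Nat.eq_zero_or_pos g with rfl | hg
  · simp [uPoly] at hu
  have h := sum_pow_smul_polyGrad_hFun (φ := MvPolynomial.eval (coords A)) (x := x)
    (by rwa [eval_comp_X]) (by rwa [eval_comp_X]) (by rwa [eval_comp_X])
  have h2 := congrArg (poissonMap A) h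
  rw [map_sum, map_zero] at h2
  simp only [map_smul, ← hamiltonianField_eq] at h2
  -- The Casimir terms drop out, leaving a relation among `D_0, …, D_{g-1}`.
  rw [← Finset.sum_range fun i => x ^ i • hamiltonianField g i A,
    ← Finset.sum_subset (Finset.range_subset_range.2 (by lia : g ≤ 2 * g + 1)) fun k _ hk => by
      rw [hamiltonianField_eq_zero A (not_lt.1 fun h => hk (Finset.mem_range.2 h)), smul_zero],
    Finset.sum_range fun i => x ^ i • hamiltonianField g i A] at h2
  simpa using Fintype.linearIndependent_iff.1 hli (fun i => x ^ (i : ℕ)) h2 ⟨0, hg⟩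

theorem fibreStratum_eq_coprimeLocus (g : ℕ) (h : ℂ[X]) :
    fibreStratum g g h = coprimeLocus g h := by
  ext A
  exact and_congr_right fun _ => mem_stratum_iff A

end Hamiltonian

end Mumford

namespace Mumford

/-! ### Zariski closures and dimension -/

section Topology

variable {σ : Type}

theorem mem_preimage_zeroLocus_iff (I : Ideal (MvPolynomial σ ℂ)) (q : AffSp σ) :
    q ∈ coords ⁻¹' MvPolynomial.zeroLocus ℂ I ↔
      I ≤ RingHom.ker (MvPolynomial.eval (coords q)) :=
  mem_zeroLocus_iff_le_ker_eval I (coords q)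

theorem closure_eq_zeroLocus (S : Set (AffSp σ)) :
    closure S = coords ⁻¹' MvPolynomial.zeroLocus ℂ
      (MvPolynomial.vanishingIdeal ℂ (coords '' S) : Ideal (MvPolynomial σ ℂ)) := by
  apply subset_antisymm
  · refine closure_minimal (fun q hq => ?_) ((isClosed_iff_zeroLocus _).2 ⟨_, rfl⟩)
    rw [mem_preimage_zeroLocus_iff]
    exact vanishingIdeal_le_ker_eval (⟨q, hq⟩ : S)
  · obtain ⟨J, hJ⟩ := (isClosed_iff_zeroLocus (closure S)).1 isClosed_closure
    intro q hq
    rw [hJ, mem_preimage_zeroLocus_iff]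
    rw [mem_preimage_zeroLocus_iff] at hq
    refine le_trans (fun F hF => ?_) hq
    rintro _ ⟨p, hp, rfl⟩
    have h := subset_closure hp
    rw [hJ, mem_preimage_zeroLocus_iff] at h
    rw [MvPolynomial.aeval_eq_eval]
    exact h hF

/-- An inducing map into the spectrum of the coordinate ring bounds the dimension of `S` by the
Krull dimension of that ring. -/
theorem isInducing_primeSpectrum_evalAt (S : Set (AffSp σ)) :
    Topology.IsInducing fun p : S =>
      (⟨RingHom.ker (evalAt S p), inferInstance⟩ : PrimeSpectrum (CoordRing S)) := by
  have hemb := (PrimeSpectrum.isClosedEmbedding_comap_of_surjective (CoordRing S)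
    (Ideal.Quotient.mk (MvPolynomial.vanishingIdeal ℂ (coords '' S)))
    Ideal.Quotient.mk_surjective).isInducing
  rw [hemb.of_comp_iff.symm]
  have h2 : Topology.IsInducing (fun p : AffSp σ =>
    (MvPolynomial.pointToPoint (coords p) : PrimeSpectrum (MvPolynomial σ ℂ))) := ⟨rfl⟩
  have h3 := h2.comp (Topology.IsInducing.subtypeVal (t := S))
  convert h3 using 1
  ext1 p
  refine PrimeSpectrum.ext ?_
  ext F
  exact (MvPolynomial.mem_vanishingIdeal_singleton_iff (coords p.1) F).symm

theorem dim_le_ringKrullDim (S : Set (AffSp σ)) : dim S ≤ ringKrullDim (CoordRing S) :=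
  (isInducing_primeSpectrum_evalAt S).topologicalKrullDim_le.trans
    (PrimeSpectrum.topologicalKrullDim_eq_ringKrullDim _).le

theorem dim_mono {S T : Set (AffSp σ)} (h : S ⊆ T) : dim S ≤ dim T :=
  (Topology.IsEmbedding.inclusion h).isInducing.topologicalKrullDim_le

/-- The points of `S` on the zero locus of an ideal. -/
def pointsOver (S : Set (AffSp σ)) (P : Ideal (MvPolynomial σ ℂ)) : Set S :=
  {q | P ≤ RingHom.ker (MvPolynomial.eval (coords q.1))}

theorem isClosed_pointsOver (S : Set (AffSp σ)) (P : Ideal (MvPolynomial σ ℂ)) :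
    IsClosed (pointsOver S P) := by
  have h : pointsOver S P = Subtype.val ⁻¹' (coords ⁻¹' MvPolynomial.zeroLocus ℂ P) := by
    ext q
    exact (mem_preimage_zeroLocus_iff P q.1).symm
  rw [h]
  exact ((isClosed_iff_zeroLocus _).2 ⟨P, rfl⟩).preimage continuous_subtype_val

/-- A prime ideal through a point of a locally closed set is recovered from the points of the set
lying over it. -/
theorem mem_of_forall_mem_pointsOver [Finite σ] {S T : Set (AffSp σ)} (hT : IsClosed T)
    (hST : S = closure S \ T) (p : S) {P : Ideal (MvPolynomial σ ℂ)} [P.IsPrime]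
    (hSP : MvPolynomial.vanishingIdeal ℂ (coords '' S) ≤ P)
    (hp : p ∈ pointsOver S P) {F : MvPolynomial σ ℂ}
    (hF : ∀ q ∈ pointsOver S P, MvPolynomial.eval (coords q.1) F = 0) : F ∈ P := by
  obtain ⟨J, rfl⟩ := (isClosed_iff_zeroLocus T).1 hT
  have hpT := (hST ▸ p.2 : p.1 ∈ closure S \ coords ⁻¹' MvPolynomial.zeroLocus ℂ J).2
  rw [mem_preimage_zeroLocus_iff, SetLike.not_le_iff_exists] at hpT
  -- An equation `s` of `T` that is nonzero at `p`, hence not in `P`. The product `F * s` vanishes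
  -- on the whole zero locus of `P`: on `S` by `F`, on `T` by `s`.
  obtain ⟨s, hsJ, hs⟩ := hpT
  have hsP : s ∉ P := fun h => hs (hp h)
  have hmem : F * s ∈ P := by
    rw [← (inferInstance : P.IsPrime).radical,
      ← MvPolynomial.vanishingIdeal_zeroLocus_eq_radical (K := ℂ)]
    intro q hq
    rw [MvPolynomial.aeval_eq_eval]
    show MvPolynomial.eval q _ = 0
    rw [mem_zeroLocus_iff_le_ker_eval] at hq
    rw [map_mul]
    by_cases hqS : coords.symm q ∈ S
    · rw [show MvPolynomial.eval q F = 0 from hF ⟨coords.symm q, hqS⟩ hq, zero_mul]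
    · have hqT : coords.symm q ∈ coords ⁻¹' MvPolynomial.zeroLocus ℂ J := by
        by_contra hqT
        refine hqS (hST ▸ ⟨?_, hqT⟩)
        rw [closure_eq_zeroLocus, mem_preimage_zeroLocus_iff]
        exact hSP.trans hq
      rw [mem_preimage_zeroLocus_iff] at hqT
      rw [show MvPolynomial.eval q s = 0 from hqT hsJ, mul_zero]
  exact ((inferInstance : P.IsPrime).mem_or_mem hmem).resolve_right hsP

theorem isIrreducible_pointsOver [Finite σ] {S T : Set (AffSp σ)} (hT : IsClosed T)
    (hST : S = closure S \ T) (p : S) {P : Ideal (MvPolynomial σ ℂ)} [P.IsPrime]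
    (hSP : MvPolynomial.vanishingIdeal ℂ (coords '' S) ≤ P) (hp : p ∈ pointsOver S P) :
    IsIrreducible (pointsOver S P) := by
  refine ⟨⟨p, hp⟩, isPreirreducible_iff_isClosed_union_isClosed.2 fun Z₁ Z₂ h₁ h₂ hZ => ?_⟩
  obtain ⟨Y₁, hY₁, rfl⟩ := isClosed_induced_iff.1 h₁
  obtain ⟨Y₂, hY₂, rfl⟩ := isClosed_induced_iff.1 h₂
  obtain ⟨J₁, rfl⟩ := (isClosed_iff_zeroLocus Y₁).1 hY₁
  obtain ⟨J₂, rfl⟩ := (isClosed_iff_zeroLocus Y₂).1 hY₂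
  by_contra! hcon
  obtain ⟨⟨q₁, hq₁, hn₁⟩, ⟨q₂, hq₂, hn₂⟩⟩ :=
    hcon.imp Set.not_subset.1 Set.not_subset.1
  rw [Set.mem_preimage, mem_preimage_zeroLocus_iff, SetLike.not_le_iff_exists] at hn₁ hn₂
  obtain ⟨F₁, hF₁, hF₁q⟩ := hn₁
  obtain ⟨F₂, hF₂, hF₂q⟩ := hn₂
  have hmem : F₁ * F₂ ∈ P := by
    refine mem_of_forall_mem_pointsOver hT hST p hSP hp fun q hq => ?_
    rw [map_mul]
    rcases hZ hq with h | h <;> rw [Set.mem_preimage, mem_preimage_zeroLocus_iff] at h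
    · rw [show MvPolynomial.eval _ F₁ = 0 from h hF₁, zero_mul]
    · rw [show MvPolynomial.eval _ F₂ = 0 from h hF₂, mul_zero]
  rcases (inferInstance : P.IsPrime).mem_or_mem hmem with h | h
  · exact hF₁q (hq₁ h)
  · exact hF₂q (hq₂ h)

/-- Primes of the local ring correspond to irreducible closed subsets of `S` through `p`, with
inclusions reversed. Distinct primes give distinct subsets because a prime is recovered from its
points in `S`. -/
theorem ringKrullDim_localRingAt_le_dim [Finite σ] {S T : Set (AffSp σ)} (hT : IsClosed T)
    (hST : S = closure S \ T) (p : S) : ringKrullDim (LocalRingAt S p) ≤ dim S := by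
  let ψ : MvPolynomial σ ℂ →+* LocalRingAt S p :=
    (algebraMap (CoordRing S) (LocalRingAt S p)).comp (Ideal.Quotient.mk _)
  have hψ (F) (hF : MvPolynomial.eval (coords p.1) F ≠ 0) : IsUnit (ψ F) :=
    IsLocalization.map_units (LocalRingAt S p)
      (⟨Ideal.Quotient.mk _ F, hF⟩ : (RingHom.ker (evalAt S p)).primeCompl)
  have hle (Q : PrimeSpectrum (LocalRingAt S p)) :
      p ∈ pointsOver S (PrimeSpectrum.comap ψ Q).asIdeal := by
    intro F hF
    by_contra h
    exact Q.2.ne_top (Ideal.eq_top_of_isUnit_mem _ hF (hψ F h))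
  have hker (Q : PrimeSpectrum (LocalRingAt S p)) :
      MvPolynomial.vanishingIdeal ℂ (coords '' S) ≤ (PrimeSpectrum.comap ψ Q).asIdeal := by
    intro F hF
    show ψ F ∈ Q.asIdeal
    rw [show ψ F = 0 by
      rw [RingHom.comp_apply, Ideal.Quotient.eq_zero_iff_mem.2 hF, map_zero]]
    exact zero_mem _
  let f : PrimeSpectrum (LocalRingAt S p) →
      (TopologicalSpace.IrreducibleCloseds S)ᵒᵈ := fun Q =>
    OrderDual.toDual ⟨pointsOver S (PrimeSpectrum.comap ψ Q).asIdeal,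
      isIrreducible_pointsOver hT hST p (hker Q) (hle Q), isClosed_pointsOver _ _⟩
  have hinj : Function.Injective (PrimeSpectrum.comap ψ) := by
    rw [PrimeSpectrum.comap_comp]
    exact (PrimeSpectrum.comap_injective_of_surjective _ Ideal.Quotient.mk_surjective).comp
      (PrimeSpectrum.localization_comap_injective _ (RingHom.ker (evalAt S p)).primeCompl)
  have hrec (Q Q' : PrimeSpectrum (LocalRingAt S p)) (h : f Q ≤ f Q') :
      (PrimeSpectrum.comap ψ Q).asIdeal ≤ (PrimeSpectrum.comap ψ Q').asIdeal := fun F hF =>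
    mem_of_forall_mem_pointsOver hT hST p (hker Q') (hle Q') fun q hq =>
      (show pointsOver S (PrimeSpectrum.comap ψ Q').asIdeal ⊆
        pointsOver S (PrimeSpectrum.comap ψ Q).asIdeal from h) hq hF
  have hmono : StrictMono f := by
    refine Monotone.strictMono_of_injective (fun Q Q' h => ?_) fun Q Q' h => ?_
    · show pointsOver S (PrimeSpectrum.comap ψ Q').asIdeal ⊆
        pointsOver S (PrimeSpectrum.comap ψ Q).asIdeal
      exact fun q hq => (Ideal.comap_mono h).trans hq
    · exact hinj (PrimeSpectrum.ext (le_antisymm (hrec _ _ h.le) (hrec _ _ h.ge)))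
  exact (Order.krullDim_le_of_strictMono f hmono).trans Order.krullDim_orderDual.le

end Topology

/-! ### Nonemptiness, dimension and the theorem -/

section Final

open Polynomial

variable {g : ℕ} {h : ℂ[X]}

theorem exists_mul_eq_of_monic (hh : h ∈ monicPolys g) :
    ∃ u w : ℂ[X], u.Monic ∧ u.natDegree = g ∧ w.Monic ∧ w.natDegree = g + 1 ∧ u * w = h := by
  have hs := IsAlgClosed.splits h
  have hcard : h.roots.toList.length = 2 * g + 1 := by
    rw [Multiset.length_toList, ← hs.natDegree_eq_card_roots, hh.2]
  let F (l : List ℂ) : ℂ[X] := ((l : Multiset ℂ).map fun a => X - C a).prod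
  refine ⟨F (h.roots.toList.take g), F (h.roots.toList.drop g),
    monic_multisetProd_X_sub_C _, ?_, monic_multisetProd_X_sub_C _, ?_, ?_⟩
  · rw [natDegree_multiset_prod_X_sub_C_eq_card, Multiset.coe_card, List.length_take]
    lia
  · rw [natDegree_multiset_prod_X_sub_C_eq_card, Multiset.coe_card, List.length_drop]
    lia
  · rw [← Multiset.prod_add, ← Multiset.map_add, Multiset.coe_add, List.take_append_drop,
      Multiset.coe_toList]
    exact (hs.eq_prod_roots_of_monic hh.1).symm

/-- Take `v = 0` and split the roots of `h` into `g` for `u` and `g+1` for `w`. Nonemptiness is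
needed because the empty set has dimension `⊥`. -/
theorem fibre_nonempty (hh : h ∈ monicPolys g) : (fibre g h).Nonempty := by
  obtain ⟨u, w, hu, hud, hw, hwd, rfl⟩ := exists_mul_eq_of_monic hh
  let a : Coord g → ℂ := Sum.elim (fun i => u.coeff i) (Sum.elim 0 fun i => w.coeff i)
  have h1 : uPoly a = u := by
    conv_rhs => rw [hu.as_sum, hud, Finset.sum_range]
    rfl
  have h2 : wPoly a = w := by
    conv_rhs => rw [hw.as_sum, hwd, Finset.sum_range]
    rfl
  have h3 : vPoly a = 0 := by simp [vPoly, a]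
  refine ⟨coords.symm a, ?_⟩
  show momentMap a = u * w
  rw [momentMap_eq, h1, h2, h3]
  ring

theorem closure_coprimeLocus (hh : h ∈ monicPolys g) : closure (coprimeLocus g h) = fibre g h := by
  rw [closure_eq_zeroLocus, vanishingIdeal_coprimeLocus hh, fibre_eq_zeroLocus hh]

theorem isClosed_fibre (hh : h ∈ monicPolys g) : IsClosed (fibre g h) :=
  (isClosed_iff_zeroLocus _).2 ⟨_, fibre_eq_zeroLocus hh⟩

theorem isClosed_setOf_common_root (x : ℂ) :
    IsClosed {A : PhaseSpace g | (uPoly (coords A)).eval x = 0 ∧ (vPoly (coords A)).eval x = 0 ∧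
      (wPoly (coords A)).eval x = 0} := by
  refine (isClosed_iff_zeroLocus _).2 ⟨Ideal.span {(uPoly MvPolynomial.X).eval (MvPolynomial.C x),
    (vPoly MvPolynomial.X).eval (MvPolynomial.C x),
    (wPoly MvPolynomial.X).eval (MvPolynomial.C x)}, ?_⟩
  ext A
  rw [mem_preimage_zeroLocus_iff, Ideal.span_le, Set.insert_subset_iff, Set.insert_subset_iff,
    Set.singleton_subset_iff]
  simp only [SetLike.mem_coe, RingHom.mem_ker, map_eval_uPoly, map_eval_vPoly, map_eval_wPoly,
    eval_comp_X, MvPolynomial.eval_C]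
  rfl

/-- Common roots on the fibre are roots of `h`, so only finitely many closed conditions are removed.
-/
theorem exists_isClosed_coprimeLocus_eq_diff (hh : h ∈ monicPolys g) :
    ∃ T : Set (PhaseSpace g), IsClosed T ∧ coprimeLocus g h = fibre g h \ T := by
  classical
  refine ⟨⋃ x ∈ h.roots.toFinset, {A : PhaseSpace g | (uPoly (coords A)).eval x = 0 ∧
    (vPoly (coords A)).eval x = 0 ∧ (wPoly (coords A)).eval x = 0},
    isClosed_biUnion_finset fun x _ => isClosed_setOf_common_root x, ?_⟩
  ext A
  refine and_congr_right fun hA => ?_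
  simp only [Set.mem_iUnion, not_exists]
  refine forall_congr' fun x => ⟨fun hx _ h => hx h, fun hx h0 => hx ?_ h0⟩
  rw [Multiset.mem_toFinset, mem_roots hh.1.ne_zero]
  exact eval_eq_zero_of_common_root hA h0.1 h0.2.1

theorem coprimeLocus_nonempty (hh : h ∈ monicPolys g) : (coprimeLocus g h).Nonempty := by
  rw [← closure_nonempty_iff, closure_coprimeLocus hh]
  exact fibre_nonempty hh

theorem dim_le_of_vanishingIdeal_eq (hh : h ∈ monicPolys g) {S : Set (PhaseSpace g)}
    (hS : MvPolynomial.vanishingIdeal ℂ (coords '' S) = fibreIdeal g h) : dim S ≤ g := by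
  refine (dim_le_ringKrullDim S).trans
    (ringKrullDim_quotient_le_of_forall_le_height (c := 2 * g + 1)
      (fun Q _ hQ => le_height_of_fibreIdeal_le hh Q (hS ▸ hQ)) ?_)
  rw [MvPolynomial.ringKrullDim_of_isNoetherianRing, ringKrullDim_eq_zero_of_field, zero_add,
    Nat.card_eq_fintype_card, card_coord, Fintype.card_fin]

theorem le_dim_coprimeLocus (hh : h ∈ monicPolys g) :
    (g : WithBot ℕ∞) ≤ dim (coprimeLocus g h) := by
  obtain ⟨p, hp⟩ := coprimeLocus_nonempty hh
  obtain ⟨T, hT, hST⟩ := exists_isClosed_coprimeLocus_eq_diff hh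
  rw [← ringKrullDim_localRingAt_of_vanishingIdeal_eq hh (vanishingIdeal_coprimeLocus hh) ⟨p, hp⟩]
  exact ringKrullDim_localRingAt_le_dim hT (by rwa [closure_coprimeLocus hh]) _

end Final

end Mumford

theorem proposition3p18 (g : ℕ) (h : Polynomial ℂ) (hh : h ∈ Mumford.monicPolys g) :
    (Mumford.IsQuasiAffineVariety (Mumford.fibreStratum g g h) ∧
      Mumford.IsSmoothOfDim (Mumford.fibreStratum g g h) g) ∧
    Mumford.boundary (Mumford.fibreStratum g g h) =
      Mumford.singularLocus (Mumford.fibre g h) ∧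
    (Mumford.IsAffineVariety (Mumford.fibre g h) ∧ Mumford.dim (Mumford.fibre g h) = g) := by
  open Mumford in
  rw [fibreStratum_eq_coprimeLocus]
  have hV := vanishingIdeal_coprimeLocus hh
  have hVf := vanishingIdeal_fibre hh
  have hle := le_dim_coprimeLocus hh
  refine ⟨⟨?_, ⟨le_antisymm (dim_le_of_vanishingIdeal_eq hh hV) hle, fun p =>
    ⟨(isSmoothAt_iff hh hV p).2 p.2.2, ringKrullDim_localRingAt_of_vanishingIdeal_eq hh hV p⟩⟩⟩,
    ?_, isClosed_fibre hh, le_antisymm (dim_le_of_vanishingIdeal_eq hh hVf)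
      (hle.trans (dim_mono fun _ hA => hA.1))⟩
  · obtain ⟨T, hT, hST⟩ := exists_isClosed_coprimeLocus_eq_diff hh
    rw [hST]
    exact (isClosed_fibre hh).isLocallyClosed.inter hT.isOpen_compl.isLocallyClosed
  · rw [boundary, closure_coprimeLocus hh]
    ext A
    constructor
    · rintro ⟨hA, hn⟩
      exact ⟨hA, fun hs => hn ⟨hA, (isSmoothAt_iff hh hVf ⟨A, hA⟩).1 hs⟩⟩
    · rintro ⟨hA, hs⟩
      exact ⟨hA, fun hn => hs ((isSmoothAt_iff hh hVf ⟨A, hA⟩).2 hn.2)⟩
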